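/- **Setting.** Let $\Lambda^\infty_\bot$ be the set of finite and infinite $\lambda$-terms, modulo renaming of bound variables, given by the coinductive reading of the grammar $M ::= x \mid \bot \mid \lambda x.M \mid (MM)$. Put $\mathbf I=\lambda x.x$, $\Omega=(\lambda x.xx)(\lambda x.xx)$, $\mathbf T=\lambda xy.x$, $\mathbf F=\lambda xy.y$. A term $M$ is *solvable* if $(\lambda x_1\ldots x_n.M)N_1\cdots N_k=_\beta\mathbf I$ for some closure $\lambda x_1\ldots x_n.M$ of $M$ and some terms $N_1,\dots,N_k$ ($k\ge 0$), and *unsolvable* otherwise. The infinitary calculus $\lambda^\infty_{\beta\bot}$ over the unsolvables has the $\beta$-rule and the rule $C[M]\to C[\bot]$ for every $M\neq\bot$ such that $M[\bot:=\Omega]$ is unsolvable; its reductions are the strongly convergent ones, of any ordinal length. A *Böhm tree* of $M$ is a normal form $N$ of $M$ in this calculus, that is, a term $N$ in $\beta\bot$-normal form to which $M$ reduces by a strongly convergent $\beta\bot$-reduction. Finite and infinite closed propositions are given by the coinductive reading of $\varphi ::= \mathbf T\mid\mathbf F\mid\bot\mid\neg\varphi\mid(\varphi\wedge\varphi)\mid(\varphi\vee\varphi)\mid(\varphi\to\varphi)$;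 those in which $\bot$ does not occur are the finite and infinite closed propositions of Boolean logic. They are read as $\lambda$-terms by the Church encoding: the constants $\mathbf T,\mathbf F,\bot$ denote the terms of the same name, and $$\neg M\equiv M\,\mathbf F\,\mathbf T,\qquad M\wedge N\equiv M\,N\,M,\qquad M\vee N\equiv M\,M\,N,\qquad M\to N\equiv M\,N\,\mathbf T .$$ **Theorem.** Every finite or infinite closed proposition $\varphi$ has exactly one Böhm tree $\mathrm{BT}(\varphi)$, and it is $\mathbf T$, $\mathbf F$ or $\bot$; these three terms are distinct. Moreover $\mathrm{BT}(\mathbf T)=\mathbf T$, $\mathrm{BT}(\mathbf F)=\mathbf F$, $\mathrm{BT}(\bot)=\bot$, and for all closed propositions $\varphi,\psi$, finite or infinite, the values $\mathrm{BT}(\neg\varphi)$, $\mathrm{BT}(\varphi\wedge\psi)$, $\mathrm{BT}(\varphi\vee\psi)$ and $\mathrm{BT}(\varphi\to\psi)$ are obtained from $\mathrm{BT}(\varphi)$ and $\mathrm{BT}(\psi)$ by the truth tables of McCarthy's left-sequential three-valued logic: for every $v\in\{\mathbf T,\mathbf F,\bot\}$, $$\begin{array}{lll} \neg\mathbf T=\mathbf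 F, & \neg\mathbf F=\mathbf T, & \neg\bot=\bot,\\ \mathbf T\wedge v=v, & \mathbf F\wedge v=\mathbf F, & \bot\wedge v=\bot,\\ \mathbf T\vee v=\mathbf T, & \mathbf F\vee v=v, & \bot\vee v=\bot,\\ (\mathbf T\to v)=v, & (\mathbf F\to v)=\mathbf T, & (\bot\to v)=\bot. \end{array}$$ In particular the infinite proposition $\neg(\neg(\neg(\ldots)))$ has Böhm tree $\bot$. -/

import Mathlib

namespace InfLam

/-! ### Finite and infinite terms of the lambda-calculus with the extra constant `⊥`

Terms are taken modulo renaming of bound variables, with de Bruijn indices. -/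

/-- The possible labels of a node of a term. -/
inductive Shape : Type
  | var (i : ℕ)
  | bot
  | lam
  | app

/-- The positions of the immediate subterms of a node. -/
def Shape.Arity : Shape → Type
  | .var _ => Empty
  | .bot => Empty
  | .lam => Unit
  | .app => Bool

/-- The polynomial functor `X ↦ ℕ + 1 + X + X × X` of the grammar
`M ::= x | ⊥ | λx.M | (M M)`. -/
def TermF : PFunctor.{0, 0} := ⟨Shape, Shape.Arity⟩

/-- Finite and infinite lambda-terms with `⊥`: the coinductive reading of the grammar. -/
abbrev Term : Type := PFunctor.M TermF

/-- A single layer of a term, with immediate subterms from `X`. -/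
inductive Node (X : Type) : Type
  | var (i : ℕ)
  | bot
  | lam (x : X)
  | app (x y : X)

def Node.toObj {X : Type} : Node X → TermF X
  | .var i => ⟨Shape.var i, fun e => Empty.elim e⟩
  | .bot => ⟨Shape.bot, fun e => Empty.elim e⟩
  | .lam x => ⟨Shape.lam, fun _ => x⟩
  | .app x y => ⟨Shape.app, fun b => Bool.rec x y b⟩

def Node.ofObj {X : Type} : TermF X → Node X
  | ⟨Shape.var i, _⟩ => .var i
  | ⟨Shape.bot, _⟩ => .bot
  | ⟨Shape.lam, f⟩ => .lam (f ())
  | ⟨Shape.app, f⟩ => .app (f false) (f true)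

theorem Node.toObj_ofObj {X : Type} (x : TermF X) : (Node.ofObj x).toObj = x := by
  rcases x with ⟨s, f⟩
  cases s
  · exact congrArg (Sigma.mk _) (funext fun e => Empty.elim e)
  · exact congrArg (Sigma.mk _) (funext fun e => Empty.elim e)
  · rfl
  · exact congrArg (Sigma.mk _) (funext fun b => by cases b <;> rfl)

theorem Node.ofObj_toObj {X : Type} (x : Node X) : Node.ofObj x.toObj = x := by
  cases x <;> rfl

namespace Term

def mk (x : Node Term) : Term := PFunctor.M.mk x.toObj

/-- The outermost layer of a term. -/
def view (t : Term) : Node Term := Node.ofObj (PFunctor.M.dest t)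

def var (i : ℕ) : Term := mk (.var i)
def bot : Term := mk .bot
def lam (M : Term) : Term := mk (.lam M)
def app (M N : Term) : Term := mk (.app M N)

theorem view_mk (x : Node Term) : (mk x).view = x := by
  rw [view, mk, PFunctor.M.dest_mk, Node.ofObj_toObj]

theorem mk_view (t : Term) : mk t.view = t := by
  rw [view, mk, Node.toObj_ofObj, PFunctor.M.mk_dest]

end Term

def Node.map {X Y : Type} (f : X → Y) : Node X → Node Y
  | .var i => .var i
  | .bot => .bot
  | .lam x => .lam (f x)
  | .app x y => .app (f x) (f y)

theorem Node.toObj_map {X Y : Type} (f : X → Y) (x : Node X) :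
    (x.map f).toObj = TermF.map f x.toObj := by
  cases x
  · exact congrArg (Sigma.mk _) (funext fun e => Empty.elim e)
  · exact congrArg (Sigma.mk _) (funext fun e => Empty.elim e)
  · rfl
  · exact congrArg (Sigma.mk _) (funext fun b => by cases b <;> rfl)

namespace Term

def buildStep {α : Type} (g : α → Term ⊕ Node α) : α ⊕ Term → TermF (α ⊕ Term)
  | .inl a =>
    match g a with
    | .inl t => TermF.map Sum.inr (PFunctor.M.dest t)
    | .inr x => (x.map Sum.inl).toObj
  | .inr t => TermF.map Sum.inr (PFunctor.M.dest t)

/-- Corecursive construction of a term: in state `a` either end with the finished term `t`, if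
`g a = inl t`, or produce one layer and continue with the states in it. -/
def build {α : Type} (g : α → Term ⊕ Node α) (a : α) : Term :=
  PFunctor.M.corec (buildStep g) (.inl a)

theorem corec_buildStep_inr {α : Type} (g : α → Term ⊕ Node α) (t : Term) :
    PFunctor.M.corec (buildStep g) (.inr t) = t := by
  have h1 := PFunctor.M.corec_unique (P := TermF) PFunctor.M.dest
    (fun t : Term => PFunctor.M.corec (buildStep g) (.inr t))
    (fun t => by rw [PFunctor.M.dest_corec]; rfl)
  have h2 := PFunctor.M.corec_unique (P := TermF) PFunctor.M.dest
    (fun t : Term => t) (fun t => rfl)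
  exact congrFun (h1.trans h2.symm) t

theorem build_eq {α : Type} (g : α → Term ⊕ Node α) (a : α) :
    build g a = Sum.elim id (fun x => mk (x.map (build g))) (g a) := by
  have h : build g a
      = PFunctor.M.mk (TermF.map (PFunctor.M.corec (buildStep g)) (buildStep g (.inl a))) := by
    rw [← PFunctor.M.dest_corec, PFunctor.M.mk_dest]; rfl
  rw [h]
  rcases hg : g a with t | x
  · have e : buildStep g (.inl a) = TermF.map Sum.inr (PFunctor.M.dest t) := by
      simp only [buildStep, hg]
    rw [e, PFunctor.map_map,
      show PFunctor.M.corec (buildStep g) ∘ Sum.inr = id from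
        funext (corec_buildStep_inr g), PFunctor.id_map, PFunctor.M.mk_dest]
    rfl
  · have e : buildStep g (.inl a) = (x.map Sum.inl).toObj := by
      simp only [buildStep, hg]
    rw [e, Node.toObj_map, PFunctor.map_map]
    show _ = PFunctor.M.mk _
    rw [Node.toObj_map]
    rfl

/-! ### Renaming and substitution -/

/-- Extension of a renaming to the scope of a binder. -/
def upRen (ρ : ℕ → ℕ) : ℕ → ℕ
  | 0 => 0
  | i + 1 => ρ i + 1

/-- Renaming of the free variables along `ρ`. -/
def rename (ρ : ℕ → ℕ) (t : Term) : Term :=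
  build (α := (ℕ → ℕ) × Term)
    (fun s => match s.2.view with
      | .var i => .inr (.var (s.1 i))
      | .bot => .inr .bot
      | .lam M => .inr (.lam (upRen s.1, M))
      | .app M N => .inr (.app (s.1, M) (s.1, N)))
    (ρ, t)

/-- Extension of a substitution to the scope of a binder. -/
def up (σ : ℕ → Term) : ℕ → Term
  | 0 => var 0
  | i + 1 => rename Nat.succ (σ i)

/-- Capture-avoiding simultaneous substitution of `σ i` for each free variable `i`. -/
def subst (σ : ℕ → Term) (t : Term) : Term :=
  build (α := (ℕ → Term) × Term)
    (fun s => match s.2.view with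
      | .var i => .inl (s.1 i)
      | .bot => .inr .bot
      | .lam M => .inr (.lam (up s.1, M))
      | .app M N => .inr (.app (s.1, M) (s.1, N)))
    (σ, t)

/-- The substitution of `N` for the variable `0`, which lowers all other variables by one. -/
def inst (N : Term) : ℕ → Term
  | 0 => N
  | i + 1 => var i

theorem rename_var (ρ : ℕ → ℕ) (i : ℕ) : rename ρ (var i) = var (ρ i) := by
  rw [rename, build_eq]; simp only [var, view_mk]; rfl
theorem rename_bot (ρ : ℕ → ℕ) : rename ρ bot = bot := by
  rw [rename, build_eq]; simp only [bot, view_mk]; rfl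
theorem rename_lam (ρ : ℕ → ℕ) (M : Term) : rename ρ (lam M) = lam (rename (upRen ρ) M) := by
  rw [rename, build_eq]; simp only [lam, view_mk]; rfl
theorem rename_app (ρ : ℕ → ℕ) (M N : Term) :
    rename ρ (app M N) = app (rename ρ M) (rename ρ N) := by
  rw [rename, build_eq]; simp only [app, view_mk]; rfl

theorem subst_var (σ : ℕ → Term) (i : ℕ) : subst σ (var i) = σ i := by
  rw [subst, build_eq]; simp only [var, view_mk]; rfl
theorem subst_bot (σ : ℕ → Term) : subst σ bot = bot := by
  rw [subst, build_eq]; simp only [bot, view_mk]; rfl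
theorem subst_lam (σ : ℕ → Term) (M : Term) : subst σ (lam M) = lam (subst (up σ) M) := by
  rw [subst, build_eq]; simp only [lam, view_mk]; rfl
theorem subst_app (σ : ℕ → Term) (M N : Term) :
    subst σ (app M N) = app (subst σ M) (subst σ N) := by
  rw [subst, build_eq]; simp only [app, view_mk]; rfl

/-! ### Special terms -/

/-- `I = λx.x` -/
def I : Term := lam (var 0)

/-- `Ω = (λx.xx)(λx.xx)` -/
def omega : Term := app (lam (app (var 0) (var 0))) (lam (app (var 0) (var 0)))

/-- `T = λxy.x` -/
def tt : Term := lam (lam (var 1))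

/-- `F = λxy.y` -/
def ff : Term := lam (lam (var 0))

/-- `M[⊥ := Ω]`, the replacement of all occurrences of `⊥` in `M` by `Ω`. -/
def fillBot (t : Term) : Term :=
  build (α := Term)
    (fun s => match s.view with
      | .var i => .inr (.var i)
      | .bot => .inl omega
      | .lam M => .inr (.lam M)
      | .app M N => .inr (.app M N))
    t

theorem fillBot_var (i : ℕ) : fillBot (var i) = var i := by
  rw [fillBot, build_eq]; simp only [var, view_mk]; rfl
theorem fillBot_bot : fillBot bot = omega := by
  rw [fillBot, build_eq]; simp only [bot, view_mk]; rfl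
theorem fillBot_lam (M : Term) : fillBot (lam M) = lam (fillBot M) := by
  rw [fillBot, build_eq]; simp only [lam, view_mk]; rfl
theorem fillBot_app (M N : Term) : fillBot (app M N) = app (fillBot M) (fillBot N) := by
  rw [fillBot, build_eq]; simp only [app, view_mk]; rfl

/-- `M N₁ … Nₖ` -/
def apps (M : Term) (Ns : List Term) : Term := Ns.foldl app M

/-- `λx₁ … xₙ.M` -/
def lams (n : ℕ) (M : Term) : Term := lam^[n] M

/-! ### Reduction -/

/-- Contraction of a subterm at depth `n` by the root rule `R`. -/
inductive StepAt (R : Term → Term → Prop) : ℕ → Term → Term → Prop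
  | root {M N : Term} : R M N → StepAt R 0 M N
  | lam {n : ℕ} {M M' : Term} : StepAt R n M M' → StepAt R (n + 1) (lam M) (lam M')
  | appL {n : ℕ} {M M' : Term} (N : Term) :
      StepAt R n M M' → StepAt R (n + 1) (app M N) (app M' N)
  | appR {n : ℕ} (M : Term) {N N' : Term} :
      StepAt R n N N' → StepAt R (n + 1) (app M N) (app M N')

/-- The rule `(λx.M) N → M[x := N]` at the root. -/
inductive BetaRoot : Term → Term → Prop
  | mk (M N : Term) : BetaRoot (app (lam M) N) (subst (inst N) M)

/-- One-step `β`-reduction. -/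
def Beta (M N : Term) : Prop := ∃ n, StepAt BetaRoot n M N

/-- `β`-convertibility. -/
def BetaEq : Term → Term → Prop := Relation.EqvGen Beta

/-- `M` is solvable if `(λx₁ … xₙ.M) N₁ … Nₖ = I` for some closure `λx₁ … xₙ.M` of `M` and some
terms `N₁, …, Nₖ`, `k ≥ 0`. The prefix abstracts the variables `0, …, n - 1`. For a closed `M`
it may be dropped, since the first `n` arguments are then erased. If all free variables of `M` are
below some bound, then this agrees with solvability of `λx₁ … xₙ.M` for any `n` above the bound. -/
def Solvable (M : Term) : Prop :=
  ∃ (n : ℕ) (Ns : List Term), BetaEq (apps (lams n M) Ns) I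

def Unsolvable (M : Term) : Prop := ¬ Solvable M

/-- The rule `M → ⊥` at the root, for every `M ≠ ⊥` such that `M[⊥ := Ω]` is unsolvable. -/
inductive BotRoot : Term → Term → Prop
  | mk (M : Term) : M ≠ bot → Unsolvable (fillBot M) → BotRoot M bot

/-- One step, at depth `n`, in the infinitary calculus `λβ⊥` over the unsolvables. -/
def BetaBotAt (n : ℕ) (M N : Term) : Prop :=
  StepAt (fun P Q => BetaRoot P Q ∨ BotRoot P Q) n M N

/-- `M` and `N` are the same above depth `n`: their distance in the tree metric is at most
`2⁻ⁿ`. -/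
inductive AgreeUpTo : ℕ → Term → Term → Prop
  | zero (M N : Term) : AgreeUpTo 0 M N
  | var (n i : ℕ) : AgreeUpTo (n + 1) (var i) (var i)
  | bot (n : ℕ) : AgreeUpTo (n + 1) bot bot
  | lam {n : ℕ} {M M' : Term} : AgreeUpTo n M M' → AgreeUpTo (n + 1) (lam M) (lam M')
  | app {n : ℕ} {M M' N N' : Term} : AgreeUpTo n M M' → AgreeUpTo n N N' →
      AgreeUpTo (n + 1) (app M N) (app M' N')

/-- `M` reduces to `N` by a strongly convergent `β⊥`-reduction of some ordinal length `α`.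
The reduction consists of terms `f β`, `β ≤ α`, and of steps from `f β` to `f (β + 1)` at depth
`d β`, `β < α`. At each limit ordinal the terms converge in the tree metric (they finally agree
with the limit to every finite depth) and the depth of the steps tends to infinity. -/
def Reduces (M N : Term) : Prop :=
  ∃ (α : Ordinal.{0}) (f : Ordinal.{0} → Term) (d : Ordinal.{0} → ℕ),
    f 0 = M ∧ f α = N ∧
    (∀ β < α, BetaBotAt (d β) (f β) (f (β + 1))) ∧
    ∀ l ≤ α, Order.IsSuccLimit l → ∀ n : ℕ, ∃ γ < l, ∀ β, γ ≤ β → β < l →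
      n ≤ d β ∧ AgreeUpTo n (f β) (f l)

/-- `M` is a `β⊥`-normal form. -/
def IsNormal (M : Term) : Prop := ∀ n N, ¬ BetaBotAt n M N

/-- `N` is a Böhm tree of `M`: a normal form of `M` in the infinitary calculus `λβ⊥`
over the unsolvables. -/
def IsBohmTree (M N : Term) : Prop := Reduces M N ∧ IsNormal N

/-! ### If-then-else and the connectives, as operations on terms -/

/-- `if B then M else N` is `B M N`. -/
def ite (B M N : Term) : Term := app (app B M) N
def neg (M : Term) : Term := ite M ff tt
def and (M N : Term) : Term := ite M N M
def or (M N : Term) : Term := ite M M N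
def imp (M N : Term) : Term := ite M N tt

end Term

/-! ### McCarthy's left-sequential three-valued logic -/

/-- The three truth values. -/
inductive Tri : Type
  | t
  | f
  | u

namespace Tri

def neg : Tri → Tri
  | t => f
  | f => t
  | u => u

def and : Tri → Tri → Tri
  | t, v => v
  | f, _ => f
  | u, _ => u

def or : Tri → Tri → Tri
  | t, _ => t
  | f, v => v
  | u, _ => u

def imp : Tri → Tri → Tri
  | t, v => v
  | f, _ => t
  | u, _ => u

/-- The encoding of the truth values as terms. -/
def toTerm : Tri → Term
  | t => Term.tt
  | f => Term.ff
  | u => Term.bot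

end Tri

/-! ### Finite and infinite closed propositions -/

/-- The possible labels of a node of a closed proposition. -/
inductive PShape : Type
  | const (v : Tri)
  | neg
  | and
  | or
  | imp

def PShape.Arity : PShape → Type
  | .const _ => Empty
  | .neg => Unit
  | _ => Bool

/-- The polynomial functor of the grammar
`φ ::= T | F | ⊥ | ¬φ | (φ ∧ φ) | (φ ∨ φ) | (φ → φ)`. -/
def PropF : PFunctor.{0, 0} := ⟨PShape, PShape.Arity⟩

/-- Finite and infinite closed propositions with constants `T`, `F` and `⊥`: the coinductive
reading of the grammar. -/
abbrev Proposition : Type := PFunctor.M PropF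

namespace Proposition

def const (v : Tri) : Proposition :=
  PFunctor.M.mk (F := PropF) ⟨PShape.const v, fun e => Empty.elim e⟩
def neg (φ : Proposition) : Proposition :=
  PFunctor.M.mk (F := PropF) ⟨PShape.neg, fun _ => φ⟩
def and (φ ψ : Proposition) : Proposition :=
  PFunctor.M.mk (F := PropF) ⟨PShape.and, fun b => Bool.rec φ ψ b⟩
def or (φ ψ : Proposition) : Proposition :=
  PFunctor.M.mk (F := PropF) ⟨PShape.or, fun b => Bool.rec φ ψ b⟩
def imp (φ ψ : Proposition) : Proposition :=
  PFunctor.M.mk (F := PropF) ⟨PShape.imp, fun b => Bool.rec φ ψ b⟩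

/-- The infinite proposition `¬(¬(¬(…)))`. -/
def russell : Proposition :=
  PFunctor.M.corec (F := PropF) (fun _ : Unit => ⟨PShape.neg, fun _ => ()⟩) ()

theorem russell_eq : russell = neg russell :=
  PFunctor.M.corec_def (F := PropF) (fun _ : Unit => ⟨PShape.neg, fun _ => ()⟩) ()

/-- One layer of the encoding. The state `(false, φ)` stands for the encoding `B M N` of `φ`, and
`(true, φ)`, for a compound `φ`, stands for its part `B M`. -/
def encodeStep (s : Bool × Proposition) : Term ⊕ Node (Bool × Proposition) :=
  match s.1, PFunctor.M.dest s.2 with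
  | _, ⟨PShape.const v, _⟩ => .inl v.toTerm
  | false, ⟨PShape.neg, _⟩ => .inr (.app (true, s.2) (false, const .t))
  | true, ⟨PShape.neg, p⟩ => .inr (.app (false, p ()) (false, const .f))
  | false, ⟨PShape.and, p⟩ => .inr (.app (true, s.2) (false, p false))
  | true, ⟨PShape.and, p⟩ => .inr (.app (false, p false) (false, p true))
  | false, ⟨PShape.or, p⟩ => .inr (.app (true, s.2) (false, p true))
  | true, ⟨PShape.or, p⟩ => .inr (.app (false, p false) (false, p false))
  | false, ⟨PShape.imp, _⟩ => .inr (.app (true, s.2) (false, const .t))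
  | true, ⟨PShape.imp, p⟩ => .inr (.app (false, p false) (false, p true))

/-- The Church encoding of a finite or infinite closed proposition: the map that satisfies the five
equations below. -/
def encode (φ : Proposition) : Term := Term.build encodeStep (false, φ)

theorem encode_const (v : Tri) : encode (const v) = v.toTerm := by
  rw [encode, Term.build_eq]; rfl

theorem encode_neg (φ : Proposition) : encode (neg φ) = (encode φ).neg := by
  have h : Term.build encodeStep (true, neg φ) = Term.app (encode φ) Term.ff := by
    rw [Term.build_eq]
    exact congrArg (Term.app (encode φ)) (encode_const .f)
  rw [encode, Term.build_eq]
  exact congrArg₂ Term.app h (encode_const .t)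

theorem encode_and (φ ψ : Proposition) : encode (and φ ψ) = (encode φ).and (encode ψ) := by
  have h : Term.build encodeStep (true, and φ ψ) = Term.app (encode φ) (encode ψ) := by
    rw [Term.build_eq]; rfl
  rw [encode, Term.build_eq]
  exact congrArg₂ Term.app h rfl

theorem encode_or (φ ψ : Proposition) : encode (or φ ψ) = (encode φ).or (encode ψ) := by
  have h : Term.build encodeStep (true, or φ ψ) = Term.app (encode φ) (encode φ) := by
    rw [Term.build_eq]; rfl
  rw [encode, Term.build_eq]
  exact congrArg₂ Term.app h rfl

theorem encode_imp (φ ψ : Proposition) : encode (imp φ ψ) = (encode φ).imp (encode ψ) := by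
  have h : Term.build encodeStep (true, imp φ ψ) = Term.app (encode φ) (encode ψ) := by
    rw [Term.build_eq]; rfl
  rw [encode, Term.build_eq]
  exact congrArg₂ Term.app h (encode_const .t)

end Proposition

end InfLam

/-! Everything is reduced to weak head evaluation on a Krivine machine (`Run`), which counts its
steps. A term has value T or F if the machine returns `tt` or `ff`, and value ⊥ if it has no weak
head normal form (`HasValue`).

Every proposition has a value (`exists_hasValue`). A compound proposition is encoded as a
conditional whose three parts are encoded propositions. If it has a weak head normal form, the run
on the condition and the run on the selected branch are strictly shorter, so induction on run length
works although the proposition itself may be infinite. The McCarthy tables then record how a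
conditional evaluates.

The value determines the Böhm tree (`HasValue.isBohmTree_iff`), without confluence of the infinitary
calculus. For existence, a run to T or F is a finite β-reduction, and a term without weak head
normal form is unsolvable after filling, so it is `bot` or one step from it. For uniqueness, two
properties are carried along transfinite reductions: having no weak head normal form, and evaluating
to a fixed λλ.i within k steps. Both survive single steps, and both are closed in the tree metric
because a finite run inspects a term only to finite depth. A normal form with either property must
be `bot` or λλ.i.

The technical core is `Cong.simulate`. The relation `Cong` covers β-steps, ⊥-steps and agreement to
finite depth at once, and transfers runs across it. A ⊥-step cannot disturb a run to T or F because
the erased subterm is inert: if some instance of it, applied to arguments, evaluated to T or F, it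
would be solvable (`inert_of_unsolvable`). -/

namespace InfLam

namespace Term

open Relation

/-! ### Constructors -/

theorem mk_injective : Function.Injective mk := fun x y h => by
  rw [← view_mk x, h, view_mk]

@[simp] theorem var_inj {i j : ℕ} : var i = var j ↔ i = j :=
  ⟨fun h => by simpa using mk_injective h, fun h => h ▸ rfl⟩
@[simp] theorem lam_inj {M N : Term} : lam M = lam N ↔ M = N :=
  ⟨fun h => by simpa using mk_injective h, fun h => h ▸ rfl⟩
@[simp] theorem app_inj {M N M' N' : Term} : app M N = app M' N' ↔ M = M' ∧ N = N' :=
  ⟨fun h => by simpa using mk_injective h, fun h => by rw [h.1, h.2]⟩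
@[simp] theorem var_ne_bot {i : ℕ} : var i ≠ bot := fun h => by simpa using mk_injective h
@[simp] theorem var_ne_lam {i : ℕ} {M : Term} : var i ≠ lam M :=
  fun h => by simpa using mk_injective h
@[simp] theorem var_ne_app {i : ℕ} {M N : Term} : var i ≠ app M N :=
  fun h => by simpa using mk_injective h
@[simp] theorem bot_ne_lam {M : Term} : bot ≠ lam M := fun h => by simpa using mk_injective h
@[simp] theorem bot_ne_app {M N : Term} : bot ≠ app M N := fun h => by simpa using mk_injective h
@[simp] theorem lam_ne_app {M N P : Term} : lam P ≠ app M N :=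
  fun h => by simpa using mk_injective h
@[simp] theorem bot_ne_var {i : ℕ} : bot ≠ var i := var_ne_bot.symm
@[simp] theorem lam_ne_var {i : ℕ} {M : Term} : lam M ≠ var i := var_ne_lam.symm
@[simp] theorem app_ne_var {i : ℕ} {M N : Term} : app M N ≠ var i := var_ne_app.symm
@[simp] theorem lam_ne_bot {M : Term} : lam M ≠ bot := bot_ne_lam.symm
@[simp] theorem app_ne_bot {M N : Term} : app M N ≠ bot := bot_ne_app.symm
@[simp] theorem app_ne_lam {M N P : Term} : app M N ≠ lam P := lam_ne_app.symm

theorem exists_shape (t : Term) :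
    (∃ i, t = var i) ∨ t = bot ∨ (∃ M, t = lam M) ∨ ∃ M N, t = app M N := by
  rcases h : t.view with i | _ | M | ⟨M, N⟩ <;> rw [← mk_view t, h]
  · exact .inl ⟨i, rfl⟩
  · exact .inr (.inl rfl)
  · exact .inr (.inr (.inl ⟨M, rfl⟩))
  · exact .inr (.inr (.inr ⟨M, N, rfl⟩))

theorem AgreeUpTo.refl (n : ℕ) (M : Term) : AgreeUpTo n M M := by
  induction n generalizing M with
  | zero => exact .zero _ _
  | succ n ih =>
    obtain ⟨i, rfl⟩ | rfl | ⟨P, rfl⟩ | ⟨P, Q, rfl⟩ := exists_shape M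
    exacts [.var _ _, .bot _, .lam (ih _), .app (ih _) (ih _)]

theorem AgreeUpTo.symm {n : ℕ} {M N : Term} (h : AgreeUpTo n M N) : AgreeUpTo n N M := by
  induction h with
  | zero M N => exact .zero _ _
  | var n i => exact .var _ _
  | bot n => exact .bot _
  | lam _ ih => exact .lam ih
  | app _ _ ih₁ ih₂ => exact .app ih₁ ih₂

theorem AgreeUpTo.lam_inv {n : ℕ} {M N : Term} (h : AgreeUpTo (n + 1) (Term.lam M) (Term.lam N)) :
    AgreeUpTo n M N := by
  generalize hs : Term.lam M = s at h
  generalize ht : Term.lam N = t at h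
  cases h <;> simp_all

theorem AgreeUpTo.app_inv {n : ℕ} {M N M' N' : Term}
    (h : AgreeUpTo (n + 1) (Term.app M N) (Term.app M' N')) :
    AgreeUpTo n M M' ∧ AgreeUpTo n N N' := by
  generalize hs : Term.app M N = s at h
  generalize ht : Term.app M' N' = t at h
  cases h <;> simp_all

/-- Agreement to every depth is a bisimulation: depth 1 fixes the root label, and depth n + 1 gives
depth n for the children. -/
theorem eq_of_agreeUpTo {M N : Term} (h : ∀ n, AgreeUpTo n M N) : M = N := by
  refine PFunctor.M.bisim (P := TermF) (fun M N => ∀ n, AgreeUpTo n M N) ?_ M N h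
  intro M N h
  have key : ∀ x y : Node Term, M = mk x → N = mk y → ∃ a f f',
      x.toObj = (⟨a, f⟩ : TermF Term) ∧ y.toObj = ⟨a, f'⟩ ∧ ∀ i, ∀ n, AgreeUpTo n (f i) (f' i) := by
    rintro x y rfl rfl
    have h1 := h 1
    generalize hs : mk x = s at h1
    generalize ht : mk y = t at h1
    cases h1 with
    | var n i =>
      cases mk_injective hs; cases mk_injective ht
      exact ⟨_, _, _, rfl, rfl, fun e => Empty.elim e⟩
    | bot =>
      cases mk_injective hs; cases mk_injective ht
      exact ⟨_, _, _, rfl, rfl, fun e => Empty.elim e⟩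
    | lam =>
      cases mk_injective hs; cases mk_injective ht
      exact ⟨_, _, _, rfl, rfl, fun _ n => (h (n + 1)).lam_inv⟩
    | app =>
      cases mk_injective hs; cases mk_injective ht
      refine ⟨_, _, _, rfl, rfl, fun b n => ?_⟩
      cases b
      exacts [(h (n + 1)).app_inv.1, (h (n + 1)).app_inv.2]
  obtain ⟨a, f, f', h1, h2, h3⟩ := key (view M) (view N) (mk_view M).symm (mk_view N).symm
  rw [view, Node.toObj_ofObj] at h1 h2
  exact ⟨a, f, f', h1, h2, h3⟩

/-- To prove two families of terms equal, it suffices that they agree one layer at a time. -/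
theorem eq_of_layers {ι : Type*} (f g : ι → Term)
    (h : ∀ n, (∀ a, AgreeUpTo n (f a) (g a)) → ∀ a, AgreeUpTo (n + 1) (f a) (g a)) (a : ι) :
    f a = g a := by
  refine eq_of_agreeUpTo fun n => ?_
  induction n generalizing a with
  | zero => exact .zero _ _
  | succ n ih => exact h n ih a

/-! ### The substitution calculus -/

theorem up_var : up var = var := by
  funext i
  cases i
  exacts [rfl, rename_var _ _]

theorem subst_id (M : Term) : subst var M = M := by
  refine eq_of_layers (fun M => subst var M) (fun M => M) (fun n ih M => ?_) M
  obtain ⟨i, rfl⟩ | rfl | ⟨P, rfl⟩ | ⟨P, Q, rfl⟩ := exists_shape M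
  · simpa only [subst_var] using .refl _ _
  · simpa only [subst_bot] using .refl _ _
  · simpa only [subst_lam, up_var] using .lam (ih P)
  · simpa only [subst_app] using .app (ih P) (ih Q)

theorem up_comp_upRen (σ : ℕ → Term) (ρ : ℕ → ℕ) : up σ ∘ upRen ρ = up (σ ∘ ρ) := by
  funext i
  cases i <;> rfl

theorem subst_rename (σ : ℕ → Term) (ρ : ℕ → ℕ) (M : Term) :
    subst σ (rename ρ M) = subst (σ ∘ ρ) M := by
  -- The family also ranges over the substitution and the renaming, since both change when a binder
  -- is crossed.
  refine eq_of_layers (fun a : (ℕ → Term) × (ℕ → ℕ) × Term => subst a.1 (rename a.2.1 a.2.2))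
    (fun a => subst (a.1 ∘ a.2.1) a.2.2) (fun n ih a => ?_) (σ, ρ, M)
  obtain ⟨σ, ρ, M⟩ := a
  obtain ⟨i, rfl⟩ | rfl | ⟨P, rfl⟩ | ⟨P, Q, rfl⟩ := exists_shape M
  · simpa only [subst_var, rename_var] using .refl _ _
  · simpa only [subst_bot, rename_bot] using .refl _ _
  · simpa only [subst_lam, rename_lam] using .lam (by simpa only [up_comp_upRen] using ih (up σ, upRen ρ, P))
  · simpa only [subst_app, rename_app] using .app (ih (σ, ρ, P)) (ih (σ, ρ, Q))

theorem rename_eq_subst (ρ : ℕ → ℕ) (M : Term) : rename ρ M = subst (fun i => var (ρ i)) M := by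
  rw [← subst_id (rename ρ M), subst_rename]
  rfl

theorem rename_rename (ρ ρ' : ℕ → ℕ) (M : Term) :
    rename ρ (rename ρ' M) = rename (ρ ∘ ρ') M := by
  rw [rename_eq_subst ρ, subst_rename, rename_eq_subst]
  rfl

theorem rename_up (ρ : ℕ → ℕ) (σ : ℕ → Term) :
    (fun i => rename (upRen ρ) (up σ i)) = up (fun i => rename ρ (σ i)) := by
  funext i
  cases i with
  | zero => exact rename_var _ _
  | succ i =>
    show rename _ (rename _ _) = rename _ (rename _ _)
    rw [rename_rename, rename_rename]
    rfl

theorem rename_subst (ρ : ℕ → ℕ) (σ : ℕ → Term) (M : Term) :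
    rename ρ (subst σ M) = subst (fun i => rename ρ (σ i)) M := by
  refine eq_of_layers (fun a : (ℕ → Term) × (ℕ → ℕ) × Term => rename a.2.1 (subst a.1 a.2.2))
    (fun a => subst (fun i => rename a.2.1 (a.1 i)) a.2.2) (fun n ih a => ?_) (σ, ρ, M)
  obtain ⟨σ, ρ, M⟩ := a
  obtain ⟨i, rfl⟩ | rfl | ⟨P, rfl⟩ | ⟨P, Q, rfl⟩ := exists_shape M
  · simpa only [subst_var, rename_var] using .refl _ _
  · simpa only [subst_bot, rename_bot] using .refl _ _
  · simpa only [subst_lam, rename_lam] using .lam (by simpa only [rename_up] using ih (up σ, upRen ρ, P))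
  · simpa only [subst_app, rename_app] using .app (ih (σ, ρ, P)) (ih (σ, ρ, Q))

theorem subst_up (τ σ : ℕ → Term) :
    (fun i => subst (up τ) (up σ i)) = up (fun i => subst τ (σ i)) := by
  funext i
  cases i with
  | zero => exact subst_var _ _
  | succ i =>
    show subst _ (rename _ _) = rename _ (subst _ _)
    rw [subst_rename, rename_subst]
    rfl

theorem subst_subst (τ σ : ℕ → Term) (M : Term) :
    subst τ (subst σ M) = subst (fun i => subst τ (σ i)) M := by
  refine eq_of_layers (fun a : (ℕ → Term) × (ℕ → Term) × Term => subst a.1 (subst a.2.1 a.2.2))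
    (fun a => subst (fun i => subst a.1 (a.2.1 i)) a.2.2) (fun n ih a => ?_) (τ, σ, M)
  obtain ⟨τ, σ, M⟩ := a
  obtain ⟨i, rfl⟩ | rfl | ⟨P, rfl⟩ | ⟨P, Q, rfl⟩ := exists_shape M
  · simpa only [subst_var] using .refl _ _
  · simpa only [subst_bot] using .refl _ _
  · simpa only [subst_lam] using .lam (by simpa only [subst_up] using ih (up τ, up σ, P))
  · simpa only [subst_app] using .app (ih (τ, σ, P)) (ih (τ, σ, Q))

theorem subst_inst_rename_succ (M N : Term) : subst (inst N) (rename Nat.succ M) = M := by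
  rw [subst_rename]
  exact subst_id M

theorem subst_inst_up (N : Term) (σ : ℕ → Term) (i : ℕ) :
    subst (inst N) (up σ i) = Nat.casesOn i N σ := by
  cases i with
  | zero => exact subst_var _ _
  | succ i => exact subst_inst_rename_succ _ _

/-- The substitution lemma, which makes root β-steps and the `pop` transition stable under
substitution. -/
theorem subst_subst_inst (σ : ℕ → Term) (M N : Term) :
    subst (inst (subst σ N)) (subst (up σ) M) = subst σ (subst (inst N) M) := by
  rw [subst_subst, subst_subst]
  congr 1
  funext i
  rw [subst_inst_up]
  cases i
  · rfl
  · exact (subst_var σ _).symm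

theorem up_agree {n : ℕ} {σ τ : ℕ → Term} (h : ∀ i < n, σ i = τ i) : ∀ i < n, up σ i = up τ i
  | 0, _ => rfl
  | i + 1, hi => by rw [up, up, h i (by omega)]

/-- Above a fixed depth only finitely many variables occur in a term. -/
theorem exists_support (d : ℕ) (M : Term) : ∃ n, ∀ σ τ : ℕ → Term, (∀ i < n, σ i = τ i) →
    AgreeUpTo d (subst σ M) (subst τ M) := by
  induction d generalizing M with
  | zero => exact ⟨0, fun _ _ _ => .zero _ _⟩
  | succ d ih =>
    obtain ⟨i, rfl⟩ | rfl | ⟨P, rfl⟩ | ⟨P, Q, rfl⟩ := exists_shape M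
    · exact ⟨i + 1, fun σ τ h => by
        rw [subst_var, subst_var, h i (by omega)]; exact .refl _ _⟩
    · exact ⟨0, fun σ τ _ => by rw [subst_bot, subst_bot]; exact .refl _ _⟩
    · obtain ⟨n, hn⟩ := ih P
      exact ⟨n, fun σ τ h => by rw [subst_lam, subst_lam]; exact .lam (hn _ _ (up_agree h))⟩
    · obtain ⟨n, hn⟩ := ih P
      obtain ⟨m, hm⟩ := ih Q
      exact ⟨n + m, fun σ τ h => by
        rw [subst_app, subst_app]
        exact .app (hn _ _ fun i hi => h i (by omega)) (hm _ _ fun i hi => h i (by omega))⟩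

/-! ### Replacement of `⊥` by `Ω` -/

theorem subst_omega (σ : ℕ → Term) : subst σ omega = omega := by
  simp only [omega, subst_app, subst_lam, subst_var, up]

theorem fillBot_rename (ρ : ℕ → ℕ) (M : Term) :
    fillBot (rename ρ M) = rename ρ (fillBot M) := by
  refine eq_of_layers (fun a : (ℕ → ℕ) × Term => fillBot (rename a.1 a.2))
    (fun a => rename a.1 (fillBot a.2)) (fun n ih a => ?_) (ρ, M)
  obtain ⟨ρ, M⟩ := a
  obtain ⟨i, rfl⟩ | rfl | ⟨P, rfl⟩ | ⟨P, Q, rfl⟩ := exists_shape M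
  · simpa only [fillBot_var, rename_var] using .refl _ _
  · simpa only [fillBot_bot, rename_bot, rename_eq_subst _ omega, subst_omega] using .refl _ _
  · simpa only [fillBot_lam, rename_lam] using .lam (ih (upRen ρ, P))
  · simpa only [fillBot_app, rename_app] using .app (ih (ρ, P)) (ih (ρ, Q))

theorem fillBot_up (σ : ℕ → Term) : (fun i => fillBot (up σ i)) = up (fun i => fillBot (σ i)) := by
  funext i
  cases i
  exacts [fillBot_var _, fillBot_rename _ _]

theorem fillBot_subst (σ : ℕ → Term) (M : Term) :
    fillBot (subst σ M) = subst (fun i => fillBot (σ i)) (fillBot M) := by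
  refine eq_of_layers (fun a : (ℕ → Term) × Term => fillBot (subst a.1 a.2))
    (fun a => subst (fun i => fillBot (a.1 i)) (fillBot a.2)) (fun n ih a => ?_) (σ, M)
  obtain ⟨σ, M⟩ := a
  obtain ⟨i, rfl⟩ | rfl | ⟨P, rfl⟩ | ⟨P, Q, rfl⟩ := exists_shape M
  · simpa only [fillBot_var, subst_var] using .refl _ _
  · simpa only [fillBot_bot, subst_bot, subst_omega] using .refl _ _
  · simpa only [fillBot_lam, subst_lam] using .lam (by simpa only [fillBot_up] using ih (up σ, P))
  · simpa only [fillBot_app, subst_app] using .app (ih (σ, P)) (ih (σ, Q))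

theorem fillBot_subst_inst (M N : Term) :
    fillBot (subst (inst N) M) = subst (inst (fillBot N)) (fillBot M) := by
  rw [fillBot_subst]
  congr 1
  funext i
  cases i
  exacts [rfl, fillBot_var _]

/-! ### Weak head evaluation with a stack of arguments -/

/-- The Krivine machine, started with the term `M` and the stack `Qs` of arguments, reaches a
state satisfying `G` in `k` steps. -/
inductive Run (G : Term → List Term → Prop) : ℕ → Term → List Term → Prop
  | done {M : Term} {Qs : List Term} : G M Qs → Run G 0 M Qs
  | push {k : ℕ} {M N : Term} {Qs : List Term} :
      Run G k M (N :: Qs) → Run G (k + 1) (app M N) Qs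
  | pop {k : ℕ} {P N : Term} {Qs : List Term} :
      Run G k (subst (inst N) P) Qs → Run G (k + 1) (lam P) (N :: Qs)

/-- The machine has no transition from the states in `G`. -/
structure Final (G : Term → List Term → Prop) : Prop where
  app : ∀ M N Qs, ¬ G (app M N) Qs
  lam : ∀ P N Qs, ¬ G (lam P) (N :: Qs)

/-- The final state with term `V` and no arguments. -/
def Val (V M : Term) (Qs : List Term) : Prop := M = V ∧ Qs = []

/-- The states that represent weak head normal forms. -/
def Whnf (M : Term) (Qs : List Term) : Prop := (∃ i, M = var i) ∨ ∃ P, M = lam P ∧ Qs = []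

theorem final_val (P : Term) : Final (Val (lam P)) :=
  ⟨fun _ _ _ h => by simp [Val] at h, fun _ _ _ h => by simp [Val] at h⟩

theorem final_whnf : Final Whnf :=
  ⟨fun _ _ _ h => by simp [Whnf] at h, fun _ _ _ h => by simp [Whnf] at h⟩

section Run

variable {G : Term → List Term → Prop}

theorem Run.app_inv (hG : Final G) {k : ℕ} {M N : Term} {Qs : List Term}
    (h : Run G k (Term.app M N) Qs) : ∃ j, k = j + 1 ∧ Run G j M (N :: Qs) := by
  generalize hs : Term.app M N = s at h
  cases h with
  | done h => subst hs; exact absurd h (hG.app _ _ _)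
  | push h => obtain ⟨rfl, rfl⟩ := app_inj.1 hs; exact ⟨_, rfl, h⟩
  | pop h => simp at hs

theorem Run.lam_inv (hG : Final G) {k : ℕ} {P N : Term} {Qs : List Term}
    (h : Run G k (Term.lam P) (N :: Qs)) : ∃ j, k = j + 1 ∧ Run G j (subst (inst N) P) Qs := by
  generalize hs : Term.lam P = s at h
  generalize ht : N :: Qs = t at h
  cases h with
  | done h => subst hs ht; exact absurd h (hG.lam _ _ _)
  | push h => simp at hs
  | pop h => obtain ⟨rfl, rfl⟩ := List.cons_eq_cons.1 ht; exact ⟨_, rfl, lam_inj.1 hs ▸ h⟩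

theorem not_run_whnf_bot {k : ℕ} {Qs : List Term} : ¬ Run Whnf k bot Qs := by
  intro h
  generalize hs : Term.bot = s at h
  cases h with
  | done h => subst hs; simp [Whnf] at h
  | push h => simp at hs
  | pop h => simp at hs

theorem not_run_whnf_omega {k : ℕ} {Qs : List Term} : ¬ Run Whnf k omega Qs := by
  intro h
  induction k using Nat.strong_induction_on with
  | _ k ih =>
    obtain ⟨k, rfl, h₁⟩ := h.app_inv final_whnf
    obtain ⟨k, rfl, h₂⟩ := h₁.lam_inv final_whnf
    rw [subst_app, subst_var] at h₂
    -- Two transitions lead from Ω back to Ω with the same stack, so a successful run would contain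
    -- a shorter one.
    exact ih k (by omega) h₂

/-- A run that returns the abstraction `V` can be continued with further arguments. -/
theorem Run.append {V : Term} {j k : ℕ} {M : Term} {Qs R : List Term} (h : Run (Val V) j M Qs)
    (hV : Run G k V R) : Run G (j + k) M (Qs ++ R) := by
  induction h with
  | done h => obtain ⟨rfl, rfl⟩ := h; simpa using hV
  | push _ ih => rw [Nat.add_right_comm]; exact .push ih
  | pop _ ih => rw [Nat.add_right_comm]; exact .pop ih

/-- The machine is deterministic, so the run on the longer stack retraces the run to `V` and still
has to finish from there. -/
theorem Run.of_append (hG : Final G) {V : Term} {j k : ℕ} {M : Term} {Qs R : List Term}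
    (h : Run (Val V) j M Qs) (h' : Run G k M (Qs ++ R)) : ∃ i ≤ k, Run G i V R := by
  induction h generalizing k with
  | done h => obtain ⟨rfl, rfl⟩ := h; exact ⟨k, le_rfl, h'⟩
  | push _ ih =>
    obtain ⟨k, rfl, h₁⟩ := h'.app_inv hG
    replace h' := h₁
    obtain ⟨i, hi, h⟩ := ih h'
    exact ⟨i, by omega, h⟩
  | pop _ ih =>
    obtain ⟨k, rfl, h₁⟩ := h'.lam_inv hG
    replace h' := h₁
    obtain ⟨i, hi, h⟩ := ih h'
    exact ⟨i, by omega, h⟩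

/-- If an instance of `M`, applied to instances of `Qs` and to further arguments, has a weak head
normal form, then so has `M` applied to `Qs`. -/
theorem Run.of_subst {σ : ℕ → Term} {k : ℕ} {M : Term} {Qs R : List Term}
    (h : Run Whnf k (subst σ M) (Qs.map (subst σ) ++ R)) : ∃ j ≤ k, Run Whnf j M Qs := by
  induction k using Nat.strong_induction_on generalizing M Qs with
  | _ k ih =>
    obtain ⟨i, rfl⟩ | rfl | ⟨P, rfl⟩ | ⟨P, Q, rfl⟩ := exists_shape M
    -- As soon as the uninstantiated run meets a variable at the head it has succeeded, whatever `σ`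
    -- puts there.
    · exact ⟨0, by omega, .done (.inl ⟨i, rfl⟩)⟩
    · rw [subst_bot] at h
      exact (not_run_whnf_bot h).elim
    · cases Qs with
      | nil => exact ⟨0, by omega, .done (.inr ⟨P, rfl, rfl⟩)⟩
      | cons N Qs =>
        rw [subst_lam, List.map_cons, List.cons_append] at h
        obtain ⟨k, rfl, h₁⟩ := h.lam_inv final_whnf
        replace h := h₁
        rw [subst_subst_inst] at h
        obtain ⟨j, hj, h⟩ := ih k (by omega) h
        exact ⟨j + 1, by omega, .pop h⟩
    · rw [subst_app] at h
      obtain ⟨k, rfl, h₁⟩ := h.app_inv final_whnf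
      replace h := h₁
      obtain ⟨j, hj, h⟩ := ih k (by omega) (M := P) (Qs := Q :: Qs) h
      exact ⟨j + 1, by omega, .push h⟩

theorem Run.of_stack_append {k : ℕ} {M : Term} {Qs R : List Term}
    (h : Run Whnf k M (Qs ++ R)) : ∃ j ≤ k, Run Whnf j M Qs := by
  refine Run.of_subst (σ := var) (R := R) ?_
  rw [subst_id, show (subst var : Term → Term) = id from funext subst_id, List.map_id]
  exact h

/-- A successful run never has an inserted Ω at the head, since Ω has no weak head normal form with
any stack. -/
theorem Run.of_fillBot {k : ℕ} {M : Term} {Qs : List Term}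
    (h : Run Whnf k (fillBot M) (Qs.map fillBot)) : Run Whnf k M Qs := by
  induction k using Nat.strong_induction_on generalizing M Qs with
  | _ k ih =>
    obtain ⟨i, rfl⟩ | rfl | ⟨P, rfl⟩ | ⟨P, Q, rfl⟩ := exists_shape M
    · rw [fillBot_var] at h
      generalize hs : Term.var i = s at h
      generalize Qs.map Term.fillBot = t at h
      cases h with
      | done h => exact .done (.inl ⟨i, hs.symm⟩)
      | push h => simp at hs
      | pop h => simp at hs
    · rw [fillBot_bot] at h
      exact (not_run_whnf_omega h).elim
    · cases Qs with
      | nil =>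
        rw [fillBot_lam] at h
        generalize hs : Term.lam _ = s at h
        generalize ht : List.map fillBot [] = t at h
        cases h with
        | done h => exact .done (.inr ⟨P, rfl, rfl⟩)
        | push h => simp at hs
        | pop h => simp at ht
      | cons N Qs =>
        rw [fillBot_lam, List.map_cons] at h
        obtain ⟨k, rfl, h₁⟩ := h.lam_inv final_whnf
        replace h := h₁
        rw [← fillBot_subst_inst] at h
        exact .pop (ih k (by omega) h)
    · rw [fillBot_app] at h
      obtain ⟨k, rfl, h₁⟩ := h.app_inv final_whnf
      replace h := h₁
      exact .push (ih k (by omega) (M := P) (Qs := Q :: Qs) h)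

theorem Run.fillBot {V : Term} {k : ℕ} {M : Term} {Qs : List Term} (h : Run (Val V) k M Qs) :
    Run (Val (fillBot V)) k (fillBot M) (Qs.map fillBot) := by
  induction h with
  | done h => obtain ⟨rfl, rfl⟩ := h; exact .done ⟨rfl, rfl⟩
  | push _ ih => rw [fillBot_app]; exact .push ih
  | pop _ ih => rw [fillBot_lam]; exact .pop (by rwa [← fillBot_subst_inst])

end Run

/-! ### A depth-indexed congruence -/

/-- Up to depth `n`, the term `M` is built like `M'` if before each layer the relation `W` may be
applied to the left-hand side; pairs in `E` are related at every depth. -/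
inductive Cong (W E : Term → Term → Prop) : ℕ → Term → Term → Prop
  | zero (M M' : Term) : Cong W E 0 M M'
  | ext {M M' : Term} (n : ℕ) : E M M' → Cong W E n M M'
  | var {M : Term} (n : ℕ) {i : ℕ} : W M (var i) → Cong W E (n + 1) M (var i)
  | bot {M : Term} (n : ℕ) : W M bot → Cong W E (n + 1) M bot
  | lam {M : Term} {n : ℕ} {P P' : Term} : W M (lam P) → Cong W E n P P' →
      Cong W E (n + 1) M (lam P')
  | app {M : Term} {n : ℕ} {P P' Q Q' : Term} : W M (app P Q) → Cong W E n P P' →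
      Cong W E n Q Q' → Cong W E (n + 1) M (app P' Q')

/-- The closure properties of `W` and `E` under which `Cong W E` is compatible with
substitution. -/
structure Compat (W E : Term → Term → Prop) : Prop where
  refl : ∀ M, W M M
  trans : ∀ {M N P}, W M N → W N P → W M P
  subst : ∀ {M N} (σ : ℕ → Term), W M N → W (subst σ M) (subst σ N)
  ext_subst : ∀ {M N} (σ τ : ℕ → Term), E M N → E (Term.subst σ M) (Term.subst τ N)
  ext_trans : ∀ {M N P}, W M N → E N P → E M P

namespace Cong

variable {W E : Term → Term → Prop}

theorem of_succ {n : ℕ} {M M' : Term} (h : Cong W E (n + 1) M M') : Cong W E n M M' := by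
  induction n generalizing M M' with
  | zero => exact .zero _ _
  | succ n ih =>
    cases h with
    | ext _ h => exact .ext _ h
    | var _ h => exact .var _ h
    | bot _ h => exact .bot _ h
    | lam h h1 => exact .lam h (ih h1)
    | app h h1 h2 => exact .app h (ih h1) (ih h2)

theorem lam_inv {n : ℕ} {M P' : Term} (h : Cong W E (n + 1) M (Term.lam P')) :
    E M (Term.lam P') ∨ ∃ P, W M (Term.lam P) ∧ Cong W E n P P' := by
  generalize hs : Term.lam P' = s at h
  cases h with
  | ext _ h => exact .inl h
  | lam h h1 => cases lam_inj.1 hs; exact .inr ⟨_, h, h1⟩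
  | _ => simp at hs

theorem app_inv {n : ℕ} {M P' Q' : Term} (h : Cong W E (n + 1) M (Term.app P' Q')) :
    E M (Term.app P' Q') ∨
      ∃ P Q, W M (Term.app P Q) ∧ Cong W E n P P' ∧ Cong W E n Q Q' := by
  generalize hs : Term.app P' Q' = s at h
  cases h with
  | ext _ h => exact .inl h
  | app h h1 h2 => obtain ⟨rfl, rfl⟩ := app_inj.1 hs; exact .inr ⟨_, _, h, h1, h2⟩
  | _ => simp at hs

theorem var_inv {n i : ℕ} {M : Term} (h : Cong W E (n + 1) M (Term.var i)) :
    E M (Term.var i) ∨ W M (Term.var i) := by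
  generalize hs : Term.var i = s at h
  cases h with
  | ext _ h => exact .inl h
  | var _ h => exact .inr h
  | _ => simp at hs

theorem of_agreeUpTo (hW : Compat W E) {n : ℕ} {M M' : Term} (h : AgreeUpTo n M M') :
    Cong W E n M M' := by
  induction h with
  | zero M N => exact .zero _ _
  | var n i => exact .var _ (hW.refl _)
  | bot n => exact .bot _ (hW.refl _)
  | lam _ ih => exact .lam (hW.refl _) ih
  | app _ _ ih₁ ih₂ => exact .app (hW.refl _) ih₁ ih₂

theorem refl (hW : Compat W E) (n : ℕ) (M : Term) : Cong W E n M M :=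
  of_agreeUpTo hW (.refl n M)

theorem prepend (hW : Compat W E) {n : ℕ} {M N M' : Term} (h : W M N) (h' : Cong W E n N M') :
    Cong W E n M M' := by
  cases h' with
  | zero => exact .zero _ _
  | ext _ h1 => exact .ext _ (hW.ext_trans h h1)
  | var _ h1 => exact .var _ (hW.trans h h1)
  | bot _ h1 => exact .bot _ (hW.trans h h1)
  | lam h1 h2 => exact .lam (hW.trans h h1) h2
  | app h1 h2 h3 => exact .app (hW.trans h h1) h2 h3

theorem rename (hW : Compat W E) {n : ℕ} {M M' : Term} (h : Cong W E n M M') (ρ : ℕ → ℕ) :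
    Cong W E n (rename ρ M) (rename ρ M') := by
  have hren : ∀ (ρ : ℕ → ℕ) {M N : Term}, W M N → W (Term.rename ρ M) (Term.rename ρ N) :=
    fun ρ M N h => by simpa only [rename_eq_subst] using hW.subst _ h
  induction h generalizing ρ with
  | zero => exact .zero _ _
  | ext n h => exact .ext n (by simpa only [rename_eq_subst] using hW.ext_subst _ _ h)
  | var n h => rw [rename_var]; exact .var n (by simpa only [rename_var] using hren ρ h)
  | bot n h => rw [rename_bot]; exact .bot n (by simpa only [rename_bot] using hren ρ h)
  | lam h _ ih =>
    rw [rename_lam]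
    exact .lam (by simpa only [rename_lam] using hren ρ h) (ih _)
  | app h _ _ ih₁ ih₂ =>
    rw [rename_app]
    exact .app (by simpa only [rename_app] using hren ρ h) (ih₁ _) (ih₂ _)

theorem up (hW : Compat W E) {n : ℕ} {σ σ' : ℕ → Term} (h : ∀ i, Cong W E n (σ i) (σ' i)) :
    ∀ i, Cong W E n (up σ i) (up σ' i)
  | 0 => refl hW n _
  | i + 1 => (h i).rename hW _

/-- No depth is lost. Where the left side is `W`-related to a variable, this survives substitution
and is prepended to the relation between the substituted terms. -/
theorem subst (hW : Compat W E) {n : ℕ} {M M' : Term} (h : Cong W E n M M') {σ σ' : ℕ → Term}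
    (hσ : ∀ i, Cong W E n (σ i) (σ' i)) : Cong W E n (subst σ M) (subst σ' M') := by
  induction h generalizing σ σ' with
  | zero => exact .zero _ _
  | ext n h => exact .ext n (hW.ext_subst _ _ h)
  | var n h =>
    have := hW.subst σ h
    rw [subst_var] at this ⊢
    exact prepend hW this (hσ _)
  | bot n h => rw [subst_bot]; exact .bot n (by simpa only [subst_bot] using hW.subst σ h)
  | lam h _ ih =>
    rw [subst_lam]
    exact .lam (by simpa only [subst_lam] using hW.subst σ h) (ih (up hW fun i => (hσ i).of_succ))
  | app h _ _ ih₁ ih₂ =>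
    rw [subst_app]
    exact .app (by simpa only [subst_app] using hW.subst σ h)
      (ih₁ fun i => (hσ i).of_succ) (ih₂ fun i => (hσ i).of_succ)

theorem subst_inst (hW : Compat W E) {n : ℕ} {M M' N N' : Term} (h : Cong W E n M M')
    (hN : Cong W E n N N') : Cong W E n (Term.subst (inst N) M) (Term.subst (inst N') M') := by
  refine h.subst hW fun i => ?_
  cases i
  exacts [hN, refl hW n _]

theorem of_stepAt (hW : Compat W E) {R : Term → Term → Prop}
    (hR : ∀ M M', R M M' → ∀ n, Cong W E n M M') {d : ℕ} {M M' : Term} (h : StepAt R d M M')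
    (n : ℕ) : Cong W E n M M' := by
  induction h generalizing n with
  | root h => exact hR _ _ h n
  | lam _ ih =>
    cases n with
    | zero => exact .zero _ _
    | succ n => exact .lam (hW.refl _) (ih n)
  | appL N _ ih =>
    cases n with
    | zero => exact .zero _ _
    | succ n => exact .app (hW.refl _) (ih n) (refl hW n _)
  | appR M _ ih =>
    cases n with
    | zero => exact .zero _ _
    | succ n => exact .app (hW.refl _) (refl hW n _) (ih n)

/-- A run of `M'` is simulated by `M`, if `M` and `M'` are related to a depth that exceeds the
length of the run. The relation `L` compares the lengths of the runs. -/
theorem simulate (hW : Compat W E) {G : Term → List Term → Prop} {L : ℕ → ℕ → Prop}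
    (hL : ∀ j k, L j k → L (j + 1) (k + 1))
    (hE : ∀ M M' k Qs, E M M' → ¬ Run G k M' Qs)
    (hWG : ∀ M N j k Qs, W M N → L j k → Run G j N Qs → ∃ i, L i k ∧ Run G i M Qs)
    -- The surplus depth 3 suffices to recognise a final state λλ.i: two abstractions and a
    -- variable.
    (hG : ∀ n M M' Qs Qs', G M' Qs' → Cong W E (n + 3) M M' →
      List.Forall₂ (Cong W E (n + 3)) Qs Qs' → ∃ j, L j 0 ∧ Run G j M Qs)
    {k : ℕ} {M' : Term} {Qs' : List Term} (h : Run G k M' Qs') {n : ℕ} {M : Term}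
    {Qs : List Term} (hM : Cong W E (n + k + 3) M M')
    (hQ : List.Forall₂ (Cong W E (n + k + 3)) Qs Qs') : ∃ j, L j k ∧ Run G j M Qs := by
  induction h generalizing M Qs with
  | done h => exact hG n _ _ _ _ h hM hQ
  | @push k M' N' Qs' h ih =>
    -- A transition uses up one layer of the head term, and the stack is weakened by one level to
    -- match.
    have hQ' := hQ.imp fun _ _ => of_succ (n := n + k + 3)
    obtain h1 | ⟨P, Q, h1, h2, h3⟩ := app_inv (n := n + k + 3) hM
    · exact (hE _ _ _ _ h1 (.push h)).elim
    · obtain ⟨j, hj, h⟩ := ih h2 (.cons h3 hQ')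
      exact hWG _ _ _ _ _ h1 (hL _ _ hj) (.push h)
  | @pop k P' N' Qs' h ih =>
    have hQ' := hQ.imp fun _ _ => of_succ (n := n + k + 3)
    obtain h1 | ⟨P, h1, h2⟩ := lam_inv (n := n + k + 3) hM
    · exact (hE _ _ _ _ h1 (.pop h)).elim
    · cases hQ' with
      | @cons N _ Qs _ h3 h4 =>
        obtain ⟨j, hj, h⟩ := ih (h2.subst_inst hW h3) h4
        exact hWG _ _ _ _ _ h1 (hL _ _ hj) (.pop h)

end Cong

theorem StepAt.flip {R : Term → Term → Prop} {d : ℕ} {M N : Term} (h : StepAt R d M N) :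
    StepAt (fun a b => R b a) d N M := by
  induction h with
  | root h => exact .root h
  | lam _ ih => exact .lam ih
  | appL N _ ih => exact .appL N ih
  | appR M _ ih => exact .appR M ih

theorem StepAt.mono {R S : Term → Term → Prop} (hRS : ∀ M N, R M N → S M N) {d : ℕ} {M N : Term}
    (h : StepAt R d M N) : StepAt S d M N := by
  induction h with
  | root h => exact .root (hRS _ _ h)
  | lam _ ih => exact .lam ih
  | appL N _ ih => exact .appL N ih
  | appR M _ ih => exact .appR M ih

/-! ### Root reduction sequences -/

theorem BetaRoot.subst {M N : Term} (h : BetaRoot M N) (σ : ℕ → Term) :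
    BetaRoot (subst σ M) (subst σ N) := by
  obtain ⟨P, Q⟩ := h
  rw [subst_app, subst_lam, ← subst_subst_inst]
  exact .mk _ _

theorem reflTransGen_betaRoot_subst {M N : Term} (h : ReflTransGen BetaRoot M N) (σ : ℕ → Term) :
    ReflTransGen BetaRoot (subst σ M) (subst σ N) :=
  h.lift _ fun _ _ h => h.subst σ

theorem eq_of_reflTransGen_betaRoot {M N : Term} (hM : ∀ P Q, M ≠ app P Q)
    (h : ReflTransGen BetaRoot M N) : N = M := by
  obtain rfl | ⟨_, h, _⟩ := h.cases_head
  · rfl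
  · cases h
    exact (hM _ _ rfl).elim

theorem Run.of_betaRoot {G : Term → List Term → Prop} {k : ℕ} {M N : Term} {Qs : List Term}
    (h : BetaRoot M N) (hN : Run G k N Qs) : Run G (k + 2) M Qs := by
  cases h
  exact .push (.pop hN)

theorem Run.betaRoot {G : Term → List Term → Prop} (hG : Final G) {k : ℕ} {M N : Term}
    {Qs : List Term} (h : BetaRoot M N) (hM : Run G k M Qs) : ∃ j ≤ k, Run G j N Qs := by
  cases h
  obtain ⟨k, rfl, h₁⟩ := hM.app_inv hG
  obtain ⟨k, rfl, h₂⟩ := h₁.lam_inv hG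
  exact ⟨k, by omega, h₂⟩

/-! ### Reduction reflects weak head normal forms -/

/-- `M` has a weak head normal form. -/
def HasWhnf (M : Term) : Prop := ∃ k, Run Whnf k M []

/-- Here the right side of `Cong` is the reduct. Anything may stand against `bot`, which never has a
weak head normal form, so unsolvability plays no role in this direction. -/
theorem compat_backward : Compat (ReflTransGen BetaRoot) (fun _ M' => M' = bot) where
  refl _ := .refl
  trans := .trans
  subst σ h := reflTransGen_betaRoot_subst h σ
  ext_subst _ _ h := by rw [h, subst_bot]
  ext_trans _ h := h

theorem hasWhnf_of_cong {k : ℕ} {M M' : Term} (hM : Run Whnf k M' [])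
    (h : Cong (ReflTransGen BetaRoot) (fun _ M' => M' = bot) (k + 3) M M') : HasWhnf M := by
  have hWG : ∀ M N j k Qs, ReflTransGen BetaRoot M N → True → Run Whnf j N Qs →
      ∃ i, (fun _ _ : ℕ => True) i k ∧ Run Whnf i M Qs := by
    intro M N j k Qs hMN _ hN
    induction hMN using ReflTransGen.head_induction_on with
    | refl => exact ⟨j, trivial, hN⟩
    | head h _ ih =>
      obtain ⟨i, -, hi⟩ := ih
      exact ⟨_, trivial, hi.of_betaRoot h⟩
  obtain ⟨j, -, hj⟩ := Cong.simulate compat_backward (L := fun _ _ => True)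
    (fun _ _ h => h) (fun M M' k Qs h h' => not_run_whnf_bot (h ▸ h')) hWG
    (fun n M M' Qs Qs' hG h hQ => by
      obtain ⟨i, rfl⟩ | ⟨P, rfl, rfl⟩ := hG
      · obtain h | h := h.var_inv
        · simp at h
        · exact hWG _ _ 0 0 _ h trivial (.done (.inl ⟨i, rfl⟩))
      · cases hQ
        obtain h | ⟨P, h, -⟩ := h.lam_inv
        · simp at h
        · exact hWG _ _ 0 0 _ h trivial (.done (.inr ⟨P, rfl, rfl⟩)))
    hM (n := 0) (by simpa using h) .nil
  exact ⟨j, hj⟩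

theorem HasWhnf.of_stepAt {R : Term → Term → Prop}
    (hR : ∀ M M', R M M' → BetaRoot M M' ∨ M' = bot) {d : ℕ} {M M' : Term} (h : StepAt R d M M')
    (hM : HasWhnf M') : HasWhnf M := by
  obtain ⟨k, hk⟩ := hM
  refine hasWhnf_of_cong hk (Cong.of_stepAt compat_backward (fun M M' h n => ?_) h _)
  obtain h | h := hR _ _ h
  · exact .prepend compat_backward (.single h) (.refl compat_backward n _)
  · exact .ext n h

theorem HasWhnf.of_agreeUpTo {M : Term} (hM : HasWhnf M) :
    ∃ n, ∀ N, AgreeUpTo n N M → HasWhnf N := by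
  obtain ⟨k, hk⟩ := hM
  exact ⟨k + 3, fun N h => hasWhnf_of_cong hk (.of_agreeUpTo compat_backward h)⟩

/-! ### Reduction preserves runs -/

/-- Here the reduct is on the left. `C` describes the subterms that may be erased to `bot`: none
(`False`) for pure β or metric agreement, the inert ones for ⊥-steps. -/
theorem compat_forward {C : Term → Prop} (hC : ∀ M σ, C M → C (subst σ M)) :
    Compat (fun M N => ReflTransGen BetaRoot N M) (fun M M' => M = bot ∧ C M') where
  refl _ := .refl
  trans h h' := h'.trans h
  subst σ h := reflTransGen_betaRoot_subst h σ
  ext_subst _ _ h := ⟨by rw [h.1, subst_bot], hC _ _ h.2⟩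
  ext_trans h h' := ⟨eq_of_reflTransGen_betaRoot (by simp) (h'.1 ▸ h), h'.2⟩

theorem Cong.of_betaRoot {C : Term → Prop} (hC : ∀ M σ, C M → C (Term.subst σ M)) {M N : Term}
    (h : BetaRoot M N) (n : ℕ) :
    Cong (fun M N => ReflTransGen BetaRoot N M) (fun M M' => M = Term.bot ∧ C M') n N M :=
  .prepend (compat_forward hC) (.single h) (.refl (compat_forward hC) n _)

theorem Run.reflTransGen_betaRoot {G : Term → List Term → Prop} (hG : Final G) (M N : Term)
    (j k : ℕ) (Qs : List Term) (h : ReflTransGen BetaRoot N M) (hj : j ≤ k) (hN : Run G j N Qs) :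
    ∃ i, i ≤ k ∧ Run G i M Qs := by
  induction h with
  | refl => exact ⟨j, hj, hN⟩
  | tail _ h ih =>
    obtain ⟨i, hi, hr⟩ := ih
    obtain ⟨l, hl, hr⟩ := hr.betaRoot hG h
    exact ⟨l, by omega, hr⟩

/-- This is restricted to β: a ⊥-step may destroy a weak head normal form, as in λx.Ω → ⊥. -/
theorem HasWhnf.beta {M N : Term} (h : Beta M N) (hM : HasWhnf M) : HasWhnf N := by
  obtain ⟨d, h⟩ := h
  obtain ⟨k, hk⟩ := hM
  have hC : ∀ (M : Term) (σ : ℕ → Term), False → False := fun _ _ h => h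
  obtain ⟨j, -, hj⟩ := Cong.simulate (compat_forward hC) (L := (· ≤ ·))
    (fun _ _ h => Nat.succ_le_succ h) (fun M M' k Qs h _ => h.2)
    (Run.reflTransGen_betaRoot final_whnf)
    (fun n M M' Qs Qs' hG h hQ => by
      obtain ⟨i, rfl⟩ | ⟨P, rfl, rfl⟩ := hG
      · obtain h | h := h.var_inv
        · exact h.2.elim
        · rw [eq_of_reflTransGen_betaRoot (by simp) h]
          exact ⟨0, le_rfl, .done (.inl ⟨i, rfl⟩)⟩
      · cases hQ
        obtain h | ⟨P, h, -⟩ := h.lam_inv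
        · exact h.2.elim
        · rw [eq_of_reflTransGen_betaRoot (by simp) h]
          exact ⟨0, le_rfl, .done (.inr ⟨P, rfl, rfl⟩)⟩)
    hk (n := 0) (Cong.of_stepAt (compat_forward hC) (fun _ _ h => .of_betaRoot hC h) h.flip _) .nil
  exact ⟨j, hj⟩

/-- No instance of `U`, applied to any arguments, evaluates to `V`. -/
def Inert (V U : Term) : Prop := ∀ σ k Qs, ¬ Run (Val V) k (subst σ U) Qs

theorem Inert.subst {V : Term} (U : Term) (σ : ℕ → Term) (h : Inert V U) :
    Inert V (subst σ U) :=
  fun τ k Qs hr => h _ k Qs (by rwa [subst_subst] at hr)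

/-- This and the next two lemmas show that no layer of λλ.i is inert. Hence none can have been
erased in the final state of a simulated run, and none is a ⊥-redex. -/
theorem not_inert_lam_lam_var (i : ℕ) :
    ¬ Inert (lam (lam (var i))) (lam (lam (var i))) := fun h =>
  h var 0 [] (.done ⟨subst_id _, rfl⟩)

theorem not_inert_lam_var (i : ℕ) : ¬ Inert (lam (lam (var i))) (lam (var i)) := fun h =>
  h (fun _ => lam (lam (var i))) 1 [lam (lam (var i))] (by
    rw [subst_lam, subst_var]
    refine .pop (.done ⟨?_, rfl⟩)
    rw [subst_inst_up]
    cases i <;> rfl)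

theorem not_inert_var (i : ℕ) : ¬ Inert (lam (lam (var i))) (var i) := fun h =>
  h (fun _ => lam (lam (var i))) 0 [] (.done ⟨subst_var _ _, rfl⟩)

theorem Run.forward {i : ℕ} {C : Term → Prop} (hC : ∀ M σ, C M → C (subst σ M))
    (hI : ∀ M, C M → Inert (Term.lam (Term.lam (Term.var i))) M) {k m : ℕ} {M M' : Term}
    {Qs : List Term} (hM : Run (Val (Term.lam (Term.lam (Term.var i)))) k M' Qs)
    (h : Cong (fun M N => ReflTransGen BetaRoot N M) (fun M M' => M = Term.bot ∧ C M')
      m M M') (hm : k + 3 ≤ m) :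
    ∃ j ≤ k, Run (Val (Term.lam (Term.lam (Term.var i)))) j M Qs := by
  obtain ⟨n, rfl⟩ := Nat.exists_eq_add_of_le' hm
  refine Cong.simulate (compat_forward hC) (L := (· ≤ ·))
    (fun _ _ h => Nat.succ_le_succ h)
    (fun M M' k Qs h hr => hI _ h.2 var k Qs (by rwa [subst_id]))
    (Run.reflTransGen_betaRoot (final_val _))
    (fun n M M' Qs Qs' hG h hQ => ?_)
    hM (n := n) h ?_
  · obtain ⟨rfl, rfl⟩ := hG
    cases hQ
    obtain h | ⟨P, h, hP⟩ := h.lam_inv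
    · exact (not_inert_lam_lam_var i (hI _ h.2)).elim
    obtain h' | ⟨P', h', hP'⟩ := hP.lam_inv
    · exact (not_inert_lam_var i (hI _ h'.2)).elim
    obtain h'' | h'' := hP'.var_inv
    · exact (not_inert_var i (hI _ h''.2)).elim
    rw [eq_of_reflTransGen_betaRoot (by simp) h''] at h'
    rw [eq_of_reflTransGen_betaRoot (by simp) h'] at h
    rw [eq_of_reflTransGen_betaRoot (by simp) h]
    exact ⟨0, le_rfl, .done ⟨rfl, rfl⟩⟩
  · exact List.forall₂_same.2 fun Q _ => .refl (compat_forward hC) _ Q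

/-! ### Solvability -/

theorem StepAt.apps {R : Term → Term → Prop} {d : ℕ} {M M' : Term} (h : StepAt R d M M')
    (Qs : List Term) : ∃ d, StepAt R d (apps M Qs) (apps M' Qs) := by
  induction Qs generalizing d M M' with
  | nil => exact ⟨d, h⟩
  | cons Q Qs ih => exact ih (.appL Q h)

theorem Run.reflTransGen_beta {V : Term} {k : ℕ} {M : Term} {Qs : List Term}
    (h : Run (Val V) k M Qs) : ReflTransGen Beta (apps M Qs) V := by
  induction h with
  | done h => obtain ⟨rfl, rfl⟩ := h; exact .refl
  | push _ ih => exact ih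
  | @pop k P N Qs _ ih =>
    exact .head (StepAt.apps (M := Term.app (Term.lam P) N) (.root (.mk _ _)) Qs) ih

theorem betaEq_of_reflTransGen {M N : Term} (h : ReflTransGen Beta M N) : BetaEq M N := by
  induction h with
  | refl => exact .refl _
  | tail _ h ih => exact ih.trans _ _ _ (.rel _ _ h)

theorem BetaEq.apps {M N : Term} (h : BetaEq M N) (Qs : List Term) :
    BetaEq (apps M Qs) (apps N Qs) := by
  induction h with
  | rel _ _ h => obtain ⟨d, h⟩ := h; exact .rel _ _ (h.apps Qs)
  | refl _ => exact .refl _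
  | symm _ _ _ ih => exact ih.symm
  | trans _ _ _ _ _ ih₁ ih₂ => exact ih₁.trans _ _ _ ih₂

/-- β-steps both preserve and reflect weak head normal forms, so the Church–Rosser property is not
needed. -/
theorem hasWhnf_congr {M N : Term} (h : BetaEq M N) : HasWhnf M ↔ HasWhnf N := by
  induction h with
  | rel _ _ h => exact ⟨.beta h, fun h' => h'.of_stepAt (fun _ _ => .inl) h.choose_spec⟩
  | refl _ => exact .rfl
  | symm _ _ _ ih => exact ih.symm
  | trans _ _ _ _ _ ih₁ ih₂ => exact ih₁.trans ih₂

theorem run_tt {G : Term → List Term → Prop} {k : ℕ} {A B : Term} {Qs : List Term}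
    (h : Run G k A Qs) : Run G (k + 2) tt (A :: B :: Qs) := by
  refine .pop ?_
  rw [subst_lam, subst_var]
  refine .pop ?_
  rwa [up, inst, subst_inst_rename_succ]

theorem run_ff {G : Term → List Term → Prop} {k : ℕ} {A B : Term} {Qs : List Term}
    (h : Run G k B Qs) : Run G (k + 2) ff (A :: B :: Qs) := by
  refine .pop ?_
  rw [subst_lam, subst_var]
  refine .pop ?_
  rwa [up, subst_var]

theorem run_lam_lam_var {G : Term → List Term → Prop} {i k : ℕ} (hi : i < 2) {A : Term}
    {Qs : List Term} (h : Run G k A Qs) : Run G (k + 2) (lam (lam (var i))) (A :: A :: Qs) := by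
  interval_cases i
  exacts [run_ff h, run_tt h]

/-- A substitution that acts on finitely many variables and lowers the others can be carried out
by abstraction and application. -/
theorem exists_run_lams {G : Term → List Term → Prop} (n : ℕ) {σ : ℕ → Term}
    (hσ : ∀ i, σ (i + n) = var i) {M : Term} {k : ℕ} {Qs : List Term}
    (h : Run G k (subst σ M) Qs) : ∃ j Ns, Run G j (lams n M) (Ns ++ Qs) := by
  induction n generalizing σ M k Qs with
  | zero =>
    rw [show σ = var from funext hσ, subst_id] at h
    exact ⟨k, [], h⟩
  | succ n ih =>
    -- Abstracting variable 0 turns `σ 0` into an argument and leaves a shifted substitution that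
    -- acts on one variable fewer.
    have h' : Run G (k + 1) (subst (fun i => σ (i + 1)) (lam M)) (σ 0 :: Qs) := by
      rw [subst_lam]
      refine .pop ?_
      rw [subst_subst]
      convert h using 2
      funext i
      rw [subst_inst_up]
      cases i <;> rfl
    obtain ⟨j, Ns, hr⟩ := ih (fun i => hσ i) h'
    exact ⟨j, Ns ++ [σ 0], by simpa [lams] using hr⟩

/-- The run sees `M` under `σ` only to depth k + 3, hence only finitely many variables. So `σ` may
be replaced by a substitution that a prefix of abstractions and arguments can perform. -/
theorem solvable_of_run {i : ℕ} (hi : i < 2) {σ : ℕ → Term} {k : ℕ} {M : Term} {Qs : List Term}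
    (h : Run (Val (lam (lam (var i)))) k (subst σ M) Qs) : Solvable M := by
  obtain ⟨n, hn⟩ := exists_support (k + 3) M
  have hC : ∀ (M : Term) (σ : ℕ → Term), False → False := fun _ _ h => h
  obtain ⟨j, -, hj⟩ := h.forward hC (fun _ h => h.elim)
    (.of_agreeUpTo (compat_forward hC)
      (hn (fun i => if i < n then σ i else var (i - n)) σ fun i hi => if_pos hi)) le_rfl
  obtain ⟨l, Ns, hl⟩ := exists_run_lams n (fun i => by simp) hj
  -- Two further arguments `I` turn T as well as F into `I`.
  have := hl.append (run_lam_lam_var hi (.done (G := Val I) (M := I) ⟨rfl, rfl⟩))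
  exact ⟨n, _, betaEq_of_reflTransGen this.reflTransGen_beta⟩

theorem inert_of_unsolvable {i : ℕ} (hi : i < 2) {M : Term} (h : Unsolvable (fillBot M)) :
    Inert (lam (lam (var i))) M := fun σ k Qs hr => by
  have hr' := hr.fillBot
  rw [fillBot_subst, fillBot_lam, fillBot_lam, fillBot_var] at hr'
  exact h (solvable_of_run hi hr')

theorem hasWhnf_of_run_lams {n k : ℕ} {σ : ℕ → Term} {M : Term} {Ns : List Term}
    (hn : n ≤ Ns.length) (h : Run Whnf k (subst σ (lams n M)) Ns) : HasWhnf M := by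
  induction n generalizing k σ Ns with
  | zero =>
    obtain ⟨j, -, hj⟩ := Run.of_subst (Qs := []) h
    exact ⟨j, hj⟩
  | succ n ih =>
    cases Ns with
    | nil => simp at hn
    | cons N Ns =>
      rw [lams, Function.iterate_succ_apply', subst_lam] at h
      obtain ⟨k, rfl, h₁⟩ := h.lam_inv final_whnf
      rw [subst_subst] at h₁
      exact ih (by simpa using hn) h₁

theorem betaEq_apps_replicate_I (n : ℕ) : BetaEq (apps I (List.replicate n I)) I := by
  induction n with
  | zero => exact .refl _
  | succ n ih =>
    have hI : BetaRoot (app I I) (subst (inst I) (var 0)) := .mk _ _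
    rw [subst_var] at hI
    have h : Beta (app I I) I := ⟨0, .root hI⟩
    exact (BetaEq.apps (.rel _ _ h) _).trans _ _ _ ih

theorem Run.of_apps {G : Term → List Term → Prop} (hG : Final G) {k : ℕ} {M : Term}
    {Qs R : List Term} (h : Run G k (apps M Qs) R) : ∃ j, Run G j M (Qs ++ R) := by
  induction Qs generalizing k M with
  | nil => exact ⟨k, h⟩
  | cons Q Qs ih =>
    obtain ⟨j, hj⟩ := ih (M := Term.app M Q) h
    obtain ⟨l, -, hl⟩ := hj.app_inv hG
    exact ⟨l, hl⟩

theorem unsolvable_fillBot {M : Term} (h : ¬ HasWhnf M) : Unsolvable (fillBot M) := by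
  rintro ⟨n, Ns, hN⟩
  -- Padding with n copies of `I` keeps the result `I` and ensures that all n abstractions are
  -- consumed; otherwise the prefix alone could be the weak head normal form.
  have h1 := (hN.apps (List.replicate n I)).trans _ _ _ (betaEq_apps_replicate_I n)
  obtain ⟨k, hk⟩ := (hasWhnf_congr h1).2 ⟨0, .done (.inr ⟨_, rfl, rfl⟩)⟩
  rw [apps, apps, ← List.foldl_append] at hk
  obtain ⟨j, hj⟩ := Run.of_apps final_whnf (Qs := Ns ++ List.replicate n I) hk
  rw [← subst_id (lams n (fillBot M))] at hj
  obtain ⟨l, hl⟩ := hasWhnf_of_run_lams (by simp) hj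
  exact h ⟨l, hl.of_fillBot⟩

/-! ### Strongly convergent reduction -/

theorem Reduces.refl (M : Term) : Reduces M M :=
  ⟨0, fun _ => M, fun _ => 0, rfl, rfl, fun _ h => absurd h (by simp),
    fun l hl h => absurd hl (not_le.2 h.bot_lt)⟩

theorem Reduces.step {M N P : Term} {n : ℕ} (h : Reduces M N) (hs : BetaBotAt n N P) :
    Reduces M P := by
  obtain ⟨α, f, d, h0, hα, hstep, hlim⟩ := h
  refine ⟨α + 1, fun β => if β ≤ α then f β else P, fun β => if β < α then d β else n, ?_, ?_,
    fun β hβ => ?_, fun l hl hlim' m => ?_⟩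
  · simpa using h0
  · simp
  · obtain h | rfl := (Order.lt_add_one_iff.1 hβ).lt_or_eq
    · simpa [h, h.le, Order.add_one_le_iff] using hstep β h
    · simpa [hα] using hs
  -- The new last index is a successor, so no new limit condition arises.
  · have hlα : l ≤ α := by
      obtain h | rfl := hl.lt_or_eq
      · exact Order.lt_add_one_iff.1 h
      · exact absurd hlim' (Order.not_isSuccLimit_add_one α)
    obtain ⟨γ, hγ, h⟩ := hlim l hlα hlim' m
    refine ⟨γ, hγ, fun β h1 h2 => ?_⟩
    have hβ := h2.trans_le hlα
    simpa [hβ, hβ.le, hlα] using h β h1 h2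

theorem Reduces.of_reflTransGen_beta {M N : Term} (h : ReflTransGen Beta M N) : Reduces M N := by
  induction h with
  | refl => exact .refl M
  | tail _ h ih =>
    obtain ⟨n, h⟩ := h
    exact ih.step (h.mono fun _ _ => .inl)

/-- A property that is preserved by steps and closed in the tree metric is preserved by strongly
convergent reduction. -/
theorem Reduces.induction {P : Term → Prop} (hstep : ∀ n M N, BetaBotAt n M N → P M → P N)
    (hlim : ∀ M, (∀ n, ∃ N, P N ∧ AgreeUpTo n N M) → P M) {M N : Term} (h : Reduces M N)
    (hM : P M) : P N := by
  obtain ⟨α, f, d, rfl, rfl, hs, hl⟩ := h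
  suffices ∀ β ≤ α, P (f β) from this α le_rfl
  intro β
  induction β using Ordinal.limitRecOn with
  | zero => exact fun _ => hM
  | add_one β ih =>
    intro h
    have h' := Order.add_one_le_iff.1 h
    exact hstep _ _ _ (hs β h') (ih h'.le)
  | limit β hβ ih =>
    intro h
    refine hlim _ fun n => ?_
    obtain ⟨γ, hγ, H⟩ := hl β h hβ n
    exact ⟨f γ, ih γ hγ (hγ.le.trans h), (H γ le_rfl hγ).2⟩

theorem not_hasWhnf_of_reduces {M N : Term} (h : Reduces M N) (hM : ¬ HasWhnf M) :
    ¬ HasWhnf N := by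
  refine h.induction (P := fun M => ¬ HasWhnf M) (fun n M N h hM hN => hM ?_) (fun M h hM => ?_) hM
  · refine hN.of_stepAt (fun P Q h => ?_) h
    obtain h | h := h
    · exact .inl h
    · cases h
      exact .inr rfl
  · obtain ⟨n, hn⟩ := hM.of_agreeUpTo
    obtain ⟨N, hN, hNM⟩ := h n
    exact hN (hn N hNM)

/-- The uniform bound `k` makes the invariant closed: at a limit, a stage that agrees to depth k + 3
is enough. -/
theorem run_of_reduces {i : ℕ} (hi : i < 2) {M N : Term} (h : Reduces M N) {k : ℕ}
    (hM : Run (Val (lam (lam (var i)))) k M []) :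
    ∃ j ≤ k, Run (Val (lam (lam (var i)))) j N [] := by
  have hC := Inert.subst (V := lam (lam (var i)))
  refine h.induction (P := fun M => ∃ j ≤ k, Run (Val (lam (lam (var i)))) j M [])
    (fun n M N h hM => ?_) (fun M h => ?_) ⟨k, le_rfl, hM⟩
  · obtain ⟨j, hj, hr⟩ := hM
    -- The step is flipped because `compat_forward` expects the reduct on the left.
    have hMN := Cong.of_stepAt (compat_forward hC) (fun P Q h n => by
      obtain h | h := h
      · exact .of_betaRoot hC h n
      · cases h with
        | mk _ h => exact .ext n ⟨rfl, inert_of_unsolvable hi h⟩) (StepAt.flip h) (j + 3)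
    obtain ⟨l, hl, hr⟩ := hr.forward hC (fun _ h => h) hMN le_rfl
    exact ⟨l, hl.trans hj, hr⟩
  · obtain ⟨N, ⟨j, hj, hr⟩, hN⟩ := h (k + 3)
    obtain ⟨l, hl, hr⟩ := hr.forward hC (fun _ h => h) (.of_agreeUpTo (compat_forward hC) hN.symm)
      (by omega)
    exact ⟨l, hl.trans hj, hr⟩

/-! ### Normal forms -/

theorem isNormal_bot : IsNormal bot := by
  intro n N h
  generalize hs : bot = s at h
  cases h with
  | root h =>
    obtain h | h := h
    · cases h; simp at hs
    · cases h with
      | mk h => exact h hs.symm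
  | _ => simp at hs

theorem isNormal_lam_lam_var {i : ℕ} (hi : i < 2) : IsNormal (lam (lam (var i))) := by
  have key : ∀ U N, ¬ Inert (lam (lam (var i))) U → (∀ P Q, U ≠ app P Q) →
      ¬ (BetaRoot U N ∨ BotRoot U N) := by
    rintro U N hU hP (h | h)
    · cases h; exact hP _ _ rfl
    · cases h with
      | mk _ h => exact hU (inert_of_unsolvable hi h)
  intro n N h
  generalize hs : lam (lam (var i)) = s at h
  cases h with
  | root h => subst hs; exact key _ _ (not_inert_lam_lam_var i) (by simp) h
  | lam h =>
    obtain rfl := lam_inj.1 hs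
    generalize ht : lam (var i) = t at h
    cases h with
    | root h => subst ht; exact key _ _ (not_inert_lam_var i) (by simp) h
    | lam h =>
      obtain rfl := lam_inj.1 ht
      generalize hu : var i = u at h
      cases h with
      | root h => subst hu; exact key _ _ (not_inert_var i) (by simp) h
      | _ => simp at hu
    | _ => simp at ht
  | _ => simp at hs

theorem IsNormal.eq_of_run {V : Term} {k : ℕ} {M : Term} (hM : IsNormal M)
    (h : Run (Val V) k M []) : M = V := by
  obtain h | ⟨_, ⟨n, h⟩, _⟩ := h.reflTransGen_beta.cases_head
  · exact h
  · exact (hM _ _ (h.mono fun _ _ => .inl)).elim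

theorem IsNormal.eq_bot {M : Term} (hM : IsNormal M) (h : ¬ HasWhnf M) : M = bot := by
  by_contra hb
  exact hM 0 bot (.root (.inr (.mk M hb (unsolvable_fillBot h))))

/-! ### Truth values of terms -/

/-- The term `M` evaluates to the truth value `v`, where `u` stands for the absence of a weak head
normal form. -/
def HasValue (M : Term) : Tri → Prop
  | .t => ∃ k, Run (Val tt) k M []
  | .f => ∃ k, Run (Val ff) k M []
  | .u => ¬ HasWhnf M

theorem hasValue_toTerm (v : Tri) : HasValue v.toTerm v := by
  cases v
  exacts [⟨0, .done ⟨rfl, rfl⟩⟩, ⟨0, .done ⟨rfl, rfl⟩⟩, fun ⟨_, h⟩ => not_run_whnf_bot h]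

theorem toTerm_injective : Function.Injective Tri.toTerm := by
  intro v w h
  cases v <;> cases w <;> first | rfl | simp [Tri.toTerm, tt, ff] at h

theorem HasValue.isBohmTree_iff {M : Term} {v : Tri} (h : HasValue M v) (N : Term) :
    IsBohmTree M N ↔ N = v.toTerm := by
  constructor
  · rintro ⟨hr, hN⟩
    cases v with
    | t =>
      obtain ⟨k, h⟩ := h
      obtain ⟨j, -, hj⟩ := run_of_reduces one_lt_two hr h
      exact hN.eq_of_run hj
    | f =>
      obtain ⟨k, h⟩ := h
      obtain ⟨j, -, hj⟩ := run_of_reduces two_pos hr h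
      exact hN.eq_of_run hj
    | u => exact hN.eq_bot (not_hasWhnf_of_reduces hr h)
  · rintro rfl
    cases v with
    | t =>
      obtain ⟨k, h⟩ := h
      exact ⟨.of_reflTransGen_beta h.reflTransGen_beta, isNormal_lam_lam_var one_lt_two⟩
    | f =>
      obtain ⟨k, h⟩ := h
      exact ⟨.of_reflTransGen_beta h.reflTransGen_beta, isNormal_lam_lam_var two_pos⟩
    | u =>
      refine ⟨?_, isNormal_bot⟩
      by_cases hb : M = bot
      · subst hb
        exact .refl _
      · exact (Reduces.refl M).step (.root (.inr (.mk M hb (unsolvable_fillBot h))))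

/-- Both values describe the same Böhm tree. -/
theorem HasValue.unique {M : Term} {v w : Tri} (hv : HasValue M v) (hw : HasValue M w) : v = w :=
  toTerm_injective <| (hw.isBohmTree_iff _).1 <| (hv.isBohmTree_iff _).2 rfl

theorem run_ite {G : Term → List Term → Prop} {k : ℕ} {B M N : Term} (h : Run G k B [M, N]) :
    Run G (k + 2) (ite B M N) [] :=
  .push (.push h)

theorem Run.ite_inv {B M N : Term} {k : ℕ} (h : Run Whnf k (ite B M N) []) :
    ∃ j, k = j + 2 ∧ Run Whnf j B [M, N] := by
  obtain ⟨j, rfl, h₁⟩ := h.app_inv final_whnf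
  obtain ⟨j, rfl, h₂⟩ := h₁.app_inv final_whnf
  exact ⟨j, rfl, h₂⟩

/-- The run of a conditional passes through the run of the chosen branch. -/
theorem Run.ite_branch {B M N : Term} {k : ℕ} (h : Run Whnf k (ite B M N) []) :
    (HasValue B .t → ∃ j < k, Run Whnf j M []) ∧ (HasValue B .f → ∃ j < k, Run Whnf j N []) := by
  obtain ⟨k, rfl, h₁⟩ := h.ite_inv
  constructor
  · rintro ⟨j, hj⟩
    obtain ⟨l, hl, h₂⟩ := hj.of_append final_whnf (R := [M, N]) h₁
    obtain ⟨l, rfl, h₃⟩ := h₂.lam_inv final_whnf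
    rw [subst_lam, subst_var] at h₃
    obtain ⟨l, rfl, h₄⟩ := h₃.lam_inv final_whnf
    rw [up, inst, subst_inst_rename_succ] at h₄
    exact ⟨l, by omega, h₄⟩
  · rintro ⟨j, hj⟩
    obtain ⟨l, hl, h₂⟩ := hj.of_append final_whnf (R := [M, N]) h₁
    obtain ⟨l, rfl, h₃⟩ := h₂.lam_inv final_whnf
    rw [subst_lam, subst_var] at h₃
    obtain ⟨l, rfl, h₄⟩ := h₃.lam_inv final_whnf
    rw [up, subst_var] at h₄
    exact ⟨l, by omega, h₄⟩

theorem Run.ite_condition {B M N : Term} {k : ℕ} (h : Run Whnf k (ite B M N) []) :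
    ∃ j < k, Run Whnf j B [] := by
  obtain ⟨k, rfl, h₁⟩ := h.ite_inv
  obtain ⟨j, hj, h⟩ := Run.of_stack_append (Qs := []) h₁
  exact ⟨j, by omega, h⟩

theorem HasValue.ite_t {B M N : Term} {v : Tri} (hB : HasValue B .t) (hM : HasValue M v) :
    HasValue (ite B M N) v := by
  obtain ⟨j, hj⟩ := id hB
  cases v with
  | u =>
    rintro ⟨k, hk⟩
    obtain ⟨l, -, hl⟩ := hk.ite_branch.1 hB
    exact hM ⟨l, hl⟩
  | _ =>
    obtain ⟨k, hk⟩ := hM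
    exact ⟨_, run_ite (hj.append (run_tt hk))⟩

theorem HasValue.ite_f {B M N : Term} {v : Tri} (hB : HasValue B .f) (hN : HasValue N v) :
    HasValue (ite B M N) v := by
  obtain ⟨j, hj⟩ := id hB
  cases v with
  | u =>
    rintro ⟨k, hk⟩
    obtain ⟨l, -, hl⟩ := hk.ite_branch.2 hB
    exact hN ⟨l, hl⟩
  | _ =>
    obtain ⟨k, hk⟩ := hN
    exact ⟨_, run_ite (hj.append (run_ff hk))⟩

theorem HasValue.ite_u {B M N : Term} (hB : HasValue B .u) : HasValue (ite B M N) .u := by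
  rintro ⟨k, hk⟩
  obtain ⟨j, -, hj⟩ := hk.ite_condition
  exact hB ⟨j, hj⟩

theorem HasValue.neg {M : Term} {v : Tri} (h : HasValue M v) : HasValue (neg M) v.neg := by
  cases v
  exacts [h.ite_t (hasValue_toTerm .f), h.ite_f (hasValue_toTerm .t), h.ite_u]

theorem HasValue.and {M N : Term} {v w : Tri} (h : HasValue M v) (h' : HasValue N w) :
    HasValue (and M N) (v.and w) := by
  cases v
  -- If the condition is false, the selected branch is `M` again, with its own value.
  exacts [h.ite_t h', h.ite_f h, h.ite_u]

theorem HasValue.or {M N : Term} {v w : Tri} (h : HasValue M v) (h' : HasValue N w) :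
    HasValue (or M N) (v.or w) := by
  cases v
  exacts [h.ite_t h, h.ite_f h', h.ite_u]

theorem HasValue.imp {M N : Term} {v w : Tri} (h : HasValue M v) (h' : HasValue N w) :
    HasValue (imp M N) (v.imp w) := by
  cases v
  exacts [h.ite_t h', h.ite_f (hasValue_toTerm .t), h.ite_u]

end Term

/-! ### Truth values of propositions -/

namespace Proposition

open Term

/-- The constants in the encodings of ¬ and → are themselves encoded propositions, so one case of
the induction on runs serves all connectives. -/
theorem encode_eq_ite (φ : Proposition) : (∃ v : Tri, encode φ = v.toTerm) ∨
    ∃ φ₁ φ₂ φ₃, encode φ = Term.ite (encode φ₁) (encode φ₂) (encode φ₃) := by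
  rw [← PFunctor.M.mk_dest φ]
  obtain ⟨s, p⟩ := PFunctor.M.dest φ
  have hp : ∀ p : Bool → Proposition, p = fun b => Bool.rec (p false) (p true) b :=
    fun p => funext fun b => by cases b <;> rfl
  cases s with
  | const v =>
    refine .inl ⟨v, ?_⟩
    rw [← encode_const]
    exact congrArg (fun p => encode (PFunctor.M.mk (F := PropF) ⟨PShape.const v, p⟩))
      (funext fun e => Empty.elim e)
  | neg =>
    refine .inr ⟨p (), const .f, const .t, ?_⟩
    rw [encode_const, encode_const]
    exact encode_neg (p ())
  | and =>
    refine .inr ⟨p false, p true, p false, ?_⟩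
    refine Eq.trans ?_ (encode_and (p false) (p true))
    exact congrArg (fun p => encode (PFunctor.M.mk (F := PropF) ⟨PShape.and, p⟩)) (hp p)
  | or =>
    refine .inr ⟨p false, p false, p true, ?_⟩
    refine Eq.trans ?_ (encode_or (p false) (p true))
    exact congrArg (fun p => encode (PFunctor.M.mk (F := PropF) ⟨PShape.or, p⟩)) (hp p)
  | imp =>
    refine .inr ⟨p false, p true, const .t, ?_⟩
    rw [encode_const]
    refine Eq.trans ?_ (encode_imp (p false) (p true))
    exact congrArg (fun p => encode (PFunctor.M.mk (F := PropF) ⟨PShape.imp, p⟩)) (hp p)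

theorem exists_hasValue_of_run {k : ℕ} {φ : Proposition} (h : Run Whnf k (encode φ) []) :
    ∃ v, HasValue (encode φ) v := by
  induction k using Nat.strong_induction_on generalizing φ with
  | _ k ih =>
    obtain ⟨v, hv⟩ | ⟨φ₁, φ₂, φ₃, hφ⟩ := encode_eq_ite φ
    · exact ⟨v, hv ▸ hasValue_toTerm v⟩
    · rw [hφ] at h ⊢
      obtain ⟨j, hj, h₁⟩ := h.ite_condition
      obtain ⟨v, hv⟩ := ih j hj h₁
      cases v with
      | t =>
        obtain ⟨l, hl, h₂⟩ := h.ite_branch.1 hv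
        obtain ⟨w, hw⟩ := ih l hl h₂
        exact ⟨w, hv.ite_t hw⟩
      | f =>
        obtain ⟨l, hl, h₂⟩ := h.ite_branch.2 hv
        obtain ⟨w, hw⟩ := ih l hl h₂
        exact ⟨w, hv.ite_f hw⟩
      | u => exact ⟨.u, hv.ite_u⟩

theorem exists_hasValue (φ : Proposition) : ∃ v, HasValue (encode φ) v := by
  by_cases h : HasWhnf (encode φ)
  · obtain ⟨k, h⟩ := h
    exact exists_hasValue_of_run h
  · exact ⟨.u, h⟩

end Proposition

end InfLam

theorem theorem1 :
    Function.Injective InfLam.Tri.toTerm ∧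
    ∃ val : InfLam.Proposition → InfLam.Tri,
      (∀ (φ : InfLam.Proposition) (N : InfLam.Term),
        InfLam.Term.IsBohmTree φ.encode N ↔ N = (val φ).toTerm) ∧
      (∀ v : InfLam.Tri, val (InfLam.Proposition.const v) = v) ∧
      (∀ φ : InfLam.Proposition, val φ.neg = (val φ).neg) ∧
      (∀ φ ψ : InfLam.Proposition, val (φ.and ψ) = (val φ).and (val ψ)) ∧
      (∀ φ ψ : InfLam.Proposition, val (φ.or ψ) = (val φ).or (val ψ)) ∧
      (∀ φ ψ : InfLam.Proposition, val (φ.imp ψ) = (val φ).imp (val ψ)) ∧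
      val InfLam.Proposition.russell = InfLam.Tri.u := by
  choose val hval using InfLam.Proposition.exists_hasValue
  have hneg : ∀ φ : InfLam.Proposition, val φ.neg = (val φ).neg := fun φ =>
    (hval φ.neg).unique (InfLam.Proposition.encode_neg φ ▸ (hval φ).neg)
  refine ⟨InfLam.Term.toTerm_injective, val, fun φ N => (hval φ).isBohmTree_iff N, fun v => ?_,
    hneg, fun φ ψ => ?_, fun φ ψ => ?_, fun φ ψ => ?_, ?_⟩
  · exact (hval _).unique (InfLam.Proposition.encode_const v ▸ InfLam.Term.hasValue_toTerm v)
  · exact (hval _).unique (InfLam.Proposition.encode_and φ ψ ▸ (hval φ).and (hval ψ))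
  · exact (hval _).unique (InfLam.Proposition.encode_or φ ψ ▸ (hval φ).or (hval ψ))
  · exact (hval _).unique (InfLam.Proposition.encode_imp φ ψ ▸ (hval φ).imp (hval ψ))
  -- The value is a fixed point of three-valued negation, and ⊥ is the only one.
  · have h := hneg InfLam.Proposition.russell
    rw [← InfLam.Proposition.russell_eq] at h
    generalize val InfLam.Proposition.russell = v at h
    cases v with
    | u => rfl
    | _ => cases h
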